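/- Let $G$ be a locally compact second countable unimodular group with a fixed Haar measure $m_G$. Call a subset of $G$ locally finite if it meets every compact set in a finite set. If $G$ acts in a Borel way on a standard Borel space $X$ and $Y\subseteq X$, put $Y_x=\{g\in G: g.x\in Y\}$ for $x\in X$. If $\mu$ is a $\sigma$-finite $G$-invariant Borel measure on $X$, a Borel set $Y\subseteq X$ is a cross section of $(X,\mu)$ if every $Y_x$ is locally finite and $Y_x\neq\varnothing$ for $\mu$-a.e. $x$. Its transverse measure is the Borel measure $\mu_Y$ on $Y$ given by $$\mu_Y(f)=\int_X\sum_{g\in Y_x}f(g.x)\,w(g)\,d\mu(x)\qquad\text{for Borel } f:Y\to[0,+\infty],$$ where $w:G\to[0,+\infty]$ is a Borel function with $\int_G w\,dm_G=1$. A transverse $G$-space $(X,\mu,Y)$ consists of a $G$-invariant Borel probability measure $\mu$ on $X$ and a cross section $Y$ of $(X,\mu)$ which is locally integrable, i.e. $\int_X|Y_x\cap K|\,d\mu(x)<+\infty$ for every compact $K\subset G$. For $r\geq 1$ let $Y^{[r]}=\{(g.y_1,\dots,g.y_r): g\in G,\ y_1,\dots,y_r\in Y\}\subseteq X^r$ with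 the diagonal action of $G$. The intersection measure $\mu^{[r]}$ is the unique $G$-invariant $\sigma$-finite measure on $Y^{[r]}$ whose transverse measure on the cross section $Y^{r}=Y\times\cdots\times Y$ of $Y^{[r]}$ is the product measure $\mu_Y^{\otimes r}$. **Proposition.** Let $(X,\mu,Y)$ be a transverse $G$-space such that $Y_{x_1}^{-1}Y_{x_2}$ is locally finite for all $x_1,x_2\in X$, and let $r\geq 2$. The measures $\mu^{[r-1]}$ and $\mu^{[r]}$ are well defined (they exist and are unique). Let $G$ act on $\overline{Y}^{[r]}=X\times Y^{[r-1]}$ through the first coordinate, $g.(x,\vec z)=(g.x,\vec z)$, and let $\overline{\mu}^{[r]}=\mu\otimes\mu^{[r-1]}$. Then $\overline{\mu}^{[r]}$ is $\sigma$-finite and $G$-invariant; $Y^{[r]}\subseteq\overline{Y}^{[r]}$ is a cross section of $(\overline{Y}^{[r]},\overline{\mu}^{[r]})$, and its return times set at $(x,\vec z)$ is nonempty whenever $Y_x\ne\varnothing$; and the transverse measure of this cross section is the intersection measure: $$\mu^{[r]}=\overline{\mu}^{[r]}_{Y^{[r]}}.$$ -/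

import Mathlib

open MeasureTheory Set TopologicalSpace
open scoped ENNReal Pointwise

namespace Transverse

section General

variable {G X : Type*}

/-- A subset of a topological space is locally finite if it meets every compact set in a finite
set. -/
def LocFinite [TopologicalSpace G] (P : Set G) : Prop :=
  ∀ K : Set G, IsCompact K → (P ∩ K).Finite

variable (G) in
/-- The return times set `Y_x = {g ∈ G : g.x ∈ Y}`. -/
def returnTimes [SMul G X] (Y : Set X) (x : X) : Set G :=
  {g | g • x ∈ Y}

variable (G) in
/-- `Y` is a cross section of the measure preserving `G`-space `(X, μ)`: it is Borel, its return
times sets are locally finite, and `G.Y` (the set of `x` with `Y_x` nonempty) is conull. -/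
structure IsCrossSection [TopologicalSpace G] [SMul G X] [MeasurableSpace X]
    (μ : Measure X) (Y : Set X) : Prop where
  measurableSet : MeasurableSet Y
  locFinite : ∀ x, LocFinite (returnTimes G Y x)
  conull : ∀ᵐ x ∂μ, (returnTimes G Y x).Nonempty

variable (G) in
/-- `Y` is a locally integrable cross section of `(X, μ)`. When `μ` is a `G`-invariant probability
measure, this says that `(X, μ, Y)` is a transverse `G`-space. -/
structure IsLocallyIntegrableCrossSection [TopologicalSpace G] [SMul G X] [MeasurableSpace X]
    (μ : Measure X) (Y : Set X) : Prop extends IsCrossSection G μ Y where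
  lintegral_lt_top : ∀ K : Set G, IsCompact K →
    ∫⁻ x, ((returnTimes G Y x ∩ K).encard : ℝ≥0∞) ∂μ < ∞

/-- A nonnegative Borel function on `G` with Haar integral `1`: the normalized indicator function
of some compact set with nonempty interior. -/
noncomputable def weight [Group G] [TopologicalSpace G] [LocallyCompactSpace G]
    [MeasurableSpace G] (m : Measure G) : G → ℝ≥0∞ :=
  let K : PositiveCompacts G := Classical.arbitrary _
  (K : Set G).indicator fun _ => (m K)⁻¹

theorem measurable_weight [Group G] [TopologicalSpace G] [LocallyCompactSpace G] [T2Space G]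
    [MeasurableSpace G] [BorelSpace G] (m : Measure G) : Measurable (weight m) :=
  measurable_const.indicator (PositiveCompacts.isCompact _).measurableSet

theorem lintegral_weight [Group G] [TopologicalSpace G] [LocallyCompactSpace G] [T2Space G]
    [MeasurableSpace G] [BorelSpace G] (m : Measure G) [m.IsHaarMeasure] :
    ∫⁻ g, weight m g ∂m = 1 := by
  set K : PositiveCompacts G := Classical.arbitrary _ with hK
  have h : weight m = (K : Set G).indicator fun _ => (m K)⁻¹ := rfl
  rw [h, lintegral_indicator K.isCompact.measurableSet, lintegral_const,
    Measure.restrict_apply_univ]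
  refine ENNReal.inv_mul_cancel ?_ K.isCompact.measure_lt_top.ne
  exact (Measure.measure_pos_of_nonempty_interior m K.interior_nonempty).ne'

/-- The transverse measure `μ_Y` on `Y`:
`μ_Y(f) = ∫_X ∑_{g ∈ Y_x} f(g.x) w(g) dμ(x)`, where `m` is the fixed Haar measure and `w` is a Borel
weight with `m(w) = 1`. It is the mixture over `x ∼ μ` of the measures
`∑_{g ∈ Y_x} w(g) δ_{g.x}`, which depend on `x` in a Borel way when `Y` is a Borel set with countable
return times sets in a Borel `G`-space. -/
noncomputable def transverseMeasure [Group G] [TopologicalSpace G] [LocallyCompactSpace G]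
    [MeasurableSpace G] [SMul G X] [MeasurableSpace X]
    (m : Measure G) (μ : Measure X) (Y : Set X) : Measure Y :=
  μ.bind fun x => Measure.sum fun g : returnTimes G Y x =>
    weight m (g : G) • Measure.dirac (⟨(g : G) • x, g.2⟩ : Y)

end General

section IntersectionSpace

variable (G : Type*) {X : Type*} [Group G] [MulAction G X]

/-- The intersection space `Y^[r] = G.(Y × ⋯ × Y) ⊆ X^r`, a `G`-invariant set under the diagonal
action of `G` on `X^r`. -/
def intersectionSpace (Y : Set X) (r : ℕ) : SubMulAction G (Fin r → X) where
  carrier := {x | ∃ (g : G) (y : Fin r → X), (∀ i, y i ∈ Y) ∧ x = g • y}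
  smul_mem' := by
    rintro h _ ⟨g, y, hy, rfl⟩
    exact ⟨h * g, y, hy, (mul_smul h g y).symm⟩

/-- The set `Y^r` as a subset of `Y^[r]`. -/
def powerSection (Y : Set X) (r : ℕ) : Set (intersectionSpace G Y r) :=
  {x | ∀ i, (x : Fin r → X) i ∈ Y}

variable {G}

/-- `ν` is a `G`-invariant `σ`-finite measure on `Y^[r]` whose transverse measure on `Y^r` is the
product measure `μ_Y ⊗ ⋯ ⊗ μ_Y`. -/
structure IsIntersectionMeasure [TopologicalSpace G] [LocallyCompactSpace G] [MeasurableSpace G]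
    [MeasurableSpace X] (m : Measure G) (μ : Measure X) (Y : Set X) (r : ℕ)
    (ν : Measure (intersectionSpace G Y r)) : Prop where
  sigmaFinite : SigmaFinite ν
  invariant : SMulInvariantMeasure G (intersectionSpace G Y r) ν
  transverse_eq :
    (transverseMeasure m ν (powerSection G Y r)).map
        (fun (z : powerSection G Y r) (i : Fin r) =>
          (⟨((z : intersectionSpace G Y r) : Fin r → X) i, z.2 i⟩ : Y)) =
      Measure.pi fun _ : Fin r => transverseMeasure m μ Y

/-- The intersection measure `μ^[r]`: the measure satisfying `IsIntersectionMeasure`. -/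
noncomputable def intersectionMeasure [TopologicalSpace G] [LocallyCompactSpace G]
    [MeasurableSpace G] [MeasurableSpace X] (m : Measure G) (μ : Measure X) (Y : Set X) (r : ℕ) :
    Measure (intersectionSpace G Y r) :=
  Classical.epsilon (IsIntersectionMeasure m μ Y r)

end IntersectionSpace

section FirstFactor

/-- The product `X × Z`, on which a group acting on `X` acts through the first coordinate only. -/
def FirstFactor (X Z : Type*) : Type _ := X × Z

instance {X Z : Type*} [MeasurableSpace X] [MeasurableSpace Z] :
    MeasurableSpace (FirstFactor X Z) :=
  inferInstanceAs (MeasurableSpace (X × Z))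

instance {G X Z : Type*} [Group G] [MulAction G X] : MulAction G (FirstFactor X Z) where
  smul g p := (g • p.1, p.2)
  one_smul p := Prod.ext (one_smul G p.1) rfl
  mul_smul g h p := Prod.ext (mul_smul g h p.1) rfl

/-- The product measure `μ ⊗ ν` on `FirstFactor X Z`. -/
noncomputable def firstFactorMeasure {X Z : Type*} [MeasurableSpace X] [MeasurableSpace Z]
    (μ : Measure X) (ν : Measure Z) : Measure (FirstFactor X Z) :=
  μ.prod ν

variable (G : Type*) {X : Type*} [Group G] [MulAction G X]

/-- The `G`-space `X × Y^[s]`, where `G` acts on the first coordinate. -/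
abbrev ExtendedSpace (Y : Set X) (s : ℕ) : Type _ :=
  FirstFactor X (intersectionSpace G Y s)

/-- The concatenation `(x, (z₁, …, z_s)) ↦ (x, z₁, …, z_s)` from `X × Y^[s]` to `X^(s+1)`. -/
def concat (Y : Set X) (s : ℕ) (p : ExtendedSpace G Y s) : Fin (s + 1) → X :=
  Fin.cons p.1 ((p.2 : intersectionSpace G Y s) : Fin s → X)

/-- The set `Y^[s+1]` as a subset of `X × Y^[s]`. -/
def intersectionSection (Y : Set X) (s : ℕ) : Set (ExtendedSpace G Y s) :=
  {p | concat G Y s p ∈ intersectionSpace G Y (s + 1)}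

/-- The identification of `Y^[s+1]`, seen as a subset of `X × Y^[s]`, with `Y^[s+1] ⊆ X^(s+1)`. -/
def sectionToSpace (Y : Set X) (s : ℕ) (p : intersectionSection G Y s) :
    intersectionSpace G Y (s + 1) :=
  ⟨concat G Y s p, p.2⟩

/-- The identification is a bijection: `Y^[s+1]` is contained in `X × Y^[s]`. -/
theorem sectionToSpace_bijective (Y : Set X) (s : ℕ) :
    Function.Bijective (sectionToSpace G Y s) := by
  constructor
  · rintro ⟨⟨x, z⟩, hp⟩ ⟨⟨x', z'⟩, hp'⟩ h
    have h1 : (Fin.cons x (z : Fin s → X) : Fin (s + 1) → X) = Fin.cons x' (z' : Fin s → X) :=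
      congrArg Subtype.val h
    have h2 := Fin.cons_injective2 h1
    obtain rfl := h2.1
    obtain rfl := Subtype.ext h2.2
    rfl
  · rintro ⟨x, hx⟩
    have ht : Fin.tail x ∈ intersectionSpace G Y s := by
      obtain ⟨g, y, hy, rfl⟩ := hx
      exact ⟨g, Fin.tail y, fun i => hy _, rfl⟩
    have hc : Fin.cons (x 0) (Fin.tail x) = x := Fin.cons_self_tail x
    let p : ExtendedSpace G Y s := (x 0, ⟨Fin.tail x, ht⟩)
    have hp : concat G Y s p ∈ intersectionSpace G Y (s + 1) := by
      change Fin.cons (x 0) (Fin.tail x) ∈ intersectionSpace G Y (s + 1)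
      exact hc.symm ▸ hx
    exact ⟨⟨p, hp⟩, Subtype.ext hc⟩

end FirstFactor

end Transverse

open Transverse

/-! Let `ν` be the intersection measure on `Y^[s]` and let `ρ` be the transverse measure of
`Y^[s+1]` with respect to `μ ⊗ ν`. The plan is to check that `ρ` has the properties characterizing
`μ^[s+1]`, and to conclude by uniqueness. The same construction gives existence by induction,
starting from the restriction of `μ` to `G.Y`.

The main tool is the identity `∫ ∑_{g ∈ S_z} F(g, g.z) dν(z) = ∫∫ F(g, y) dm(g) dν_S(y)`
(`lintegral_tsum_returnTimes`), whose proof uses unimodularity. It shows that any Borel weight of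
integral one defines the same transverse measure, that transverse measures are `σ`-finite, and that
an invariant measure for which almost every orbit meets the cross section is determined by its
transverse measure.

The return times of `(x, z)` to `Y^[s+1]` lie in `Y_{z_1}⁻¹ Y_x`, hence are locally finite. The
measure `ρ` is invariant because moving `z` by `c` preserves `μ ⊗ ν` and left translates return
times, which only replaces the weight by a translate. Finally, the transverse measure of `ρ` on `a ⊗
b` is the integral of `∑_g ∑_h w(g) w(h) a(hg.x) b(h.z)`. With `k = hg` it becomes `∑_h w(h) b(h.z)
∑_k w(h⁻¹k) a(k.x)`. Integrating in `x` turns the inner sum into `μ_Y(a)`, whatever `h` is, and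
`ν_{Y^s}(b)` remains.

All these sums must be Borel in the base point. Novikov separation shows that Borel sets with
compact sections have Borel projections; it follows that a Borel set with locally finite sections is
a countable union of Borel graphs, over which sums are visibly Borel. -/

namespace Transverse

/-! ### Novikov's separation theorem -/

section Novikov

variable {α : Type*} [MeasurableSpace α]

/-- A sequence of sets is Borel separable if its members can be enlarged to measurable sets with
empty intersection. -/
def SeqSeparable (s : ℕ → Set α) : Prop :=
  ∃ t : ℕ → Set α, (∀ n, MeasurableSet (t n)) ∧ (∀ n, s n ⊆ t n) ∧ ⋂ n, t n = ∅

/-- Take the union over `i` of the enlargements at index `k` and their intersection at every other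
index. Contrapositively, non-separability passes to some piece of a countable cover, which drives
the tree argument below. -/
theorem SeqSeparable.of_iUnion {ι : Type*} [Countable ι] {s : ℕ → Set α} {k : ℕ} {u : ι → Set α}
    (hk : s k ⊆ ⋃ i, u i) (h : ∀ i, SeqSeparable (Function.update s k (u i))) :
    SeqSeparable s := by
  classical
  by_cases hι : Nonempty ι
  swap
  · rw [not_nonempty_iff] at hι
    refine ⟨Function.update (fun _ => univ) k ∅, fun n => ?_, fun n => ?_, ?_⟩
    · by_cases hn : n = k
      · subst hn; simp
      · simp [hn]
    · by_cases hn : n = k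
      · subst hn; simpa using hk
      · simp [hn]
    · exact eq_empty_of_subset_empty fun x hx => by simpa using mem_iInter.1 hx k
  choose t ht hst ht0 using h
  refine ⟨fun n => if n = k then ⋃ i, t i k else ⋂ i, t i n, fun n => ?_, fun n => ?_, ?_⟩
  · dsimp only
    split_ifs
    · exact .iUnion fun i => ht i k
    · exact .iInter fun i => ht i n
  · dsimp only
    split_ifs with hn
    · subst hn
      refine hk.trans (iUnion_mono fun i => ?_)
      simpa using hst i n
    · refine subset_iInter fun i => ?_
      simpa [hn] using hst i n
  · refine eq_empty_of_forall_notMem fun x hx => ?_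
    rw [mem_iInter] at hx
    have h1 := hx k
    simp only [if_true, mem_iUnion] at h1
    obtain ⟨i, hi⟩ := h1
    refine notMem_empty x (ht0 i ▸ mem_iInter.2 fun n => ?_)
    by_cases hn : n = k
    · subst hn; exact hi
    · have := hx n
      simp only [hn, if_false, mem_iInter] at this
      exact this i

variable [TopologicalSpace α] [T2Space α] [OpensMeasurableSpace α]

-- If separation fails, subdivide one coordinate at a time, keeping it false, to produce a branch
-- `x`. The values of the maps at `x` cannot all agree, since the ranges have empty intersection.
-- Disjoint neighbourhoods of two distinct values then separate the images of small cylinders, a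
-- contradiction. The pairing function lets a single sequence carry the arguments of all the maps.
open PiNat in
theorem seqSeparable_range {f : ℕ → (ℕ → ℕ) → α} (hf : ∀ n, Continuous (f n))
    (h : ⋂ n, range (f n) = ∅) : SeqSeparable fun n => range (f n) := by
  by_contra hcon
  let F : ℕ → (ℕ → ℕ) → α := fun n x => f n fun j => x (Nat.pair n j)
  have hF : ∀ n, Continuous (F n) := fun n =>
    (hf n).comp (continuous_pi fun j => continuous_apply _)
  have hsplit : ∀ x m, ¬ SeqSeparable (fun n => F n '' PiNat.cylinder x m) →
      ∃ i, ¬ SeqSeparable (fun n => F n '' PiNat.cylinder (Function.update x m i) (m + 1)) := by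
    intro x m
    contrapose!
    intro H
    refine SeqSeparable.of_iUnion (k := (Nat.unpair m).1)
      (u := fun i => F (Nat.unpair m).1 '' PiNat.cylinder (Function.update x m i) (m + 1)) ?_ ?_
    · rw [← image_iUnion]
      exact image_mono (iUnion_cylinder_update (E := fun _ => ℕ) x m).ge
    · intro i
      obtain ⟨t, ht, hst, ht0⟩ := H i
      refine ⟨t, ht, fun n => ?_, ht0⟩
      by_cases hn : n = (Nat.unpair m).1
      · subst hn
        simpa using hst _
      · rw [Function.update_of_ne hn]
        -- Coordinate `m` belongs to the argument of the map numbered `(Nat.unpair m).1`, so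
        -- overwriting it does not change `F n`.
        refine subset_trans ?_ (hst n)
        rintro _ ⟨y, hy, rfl⟩
        refine ⟨Function.update y m i, ?_, ?_⟩
        · rw [mem_cylinder_iff] at hy ⊢
          intro j hj
          by_cases hjm : j = m
          · subst hjm; simp
          · simp [hjm, hy j (by omega)]
        · simp only [F]
          congr 1
          ext j
          rw [Function.update_of_ne]
          rintro rfl
          simp at hn
  choose! c hc using hsplit
  let u : ℕ → ℕ → ℕ := fun m => Nat.rec (fun _ => 0) (fun m x => Function.update x m (c x m)) m
  have hu : ∀ m, u (m + 1) = Function.update (u m) m (c (u m) m) := fun m => rfl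
  have hsep : ∀ m, ¬ SeqSeparable (fun n => F n '' PiNat.cylinder (u m) m) := by
    intro m
    induction m with
    | zero =>
      simp only [cylinder_zero, image_univ]
      refine fun ⟨t, ht, hst, ht0⟩ => hcon ⟨t, ht, fun n => subset_trans ?_ (hst n), ht0⟩
      rintro _ ⟨y, rfl⟩
      exact ⟨fun j => y (Nat.unpair j).2, by simp [F]⟩
    | succ m ih => exact hc _ _ ih
  let x : ℕ → ℕ := fun m => u (m + 1) m
  have hx : ∀ m, ∀ j < m, u m j = x j := by
    intro m
    induction m with
    | zero => simp
    | succ m ih =>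
      intro j hj
      rcases Nat.lt_succ_iff_lt_or_eq.1 hj with hj | rfl
      · rw [hu, Function.update_of_ne hj.ne, ih j hj]
      · rfl
  have hcyl : ∀ m, PiNat.cylinder (u m) m = PiNat.cylinder x m := fun m =>
    (mem_cylinder_iff_eq.1 (mem_cylinder_iff.2 (hx m)))
  obtain ⟨k, hk⟩ : ∃ k, F k x ≠ F 0 x := by
    by_contra! hall
    refine notMem_empty (F 0 x) (h ▸ mem_iInter.2 fun n => ?_)
    rw [← hall n]
    exact mem_range_self _
  have hk0 : k ≠ 0 := by rintro rfl; exact hk rfl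
  obtain ⟨U, V, hU, hV, hxU, hxV, hUV⟩ := t2_separation hk
  have hmem : ∀ n (W : Set α), IsOpen W → F n x ∈ W →
      ∃ N, ∀ m ≥ N, F n '' PiNat.cylinder x m ⊆ W := by
    intro n W hW hxW
    have hW' : (F n) ⁻¹' W ∈ nhds x := (hF n).continuousAt.preimage_mem_nhds (hW.mem_nhds hxW)
    obtain ⟨_, ⟨⟨y, N, rfl⟩, hxy, hyW⟩⟩ := (isTopologicalBasis_cylinders
      (E := fun _ : ℕ => ℕ)).mem_nhds_iff.1 hW'
    refine ⟨N, fun m hm => image_subset_iff.2 (subset_trans ?_ hyW)⟩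
    rw [← mem_cylinder_iff_eq.1 hxy]
    exact cylinder_anti x hm
  obtain ⟨N₁, h₁⟩ := hmem k U hU hxU
  obtain ⟨N₂, h₂⟩ := hmem 0 V hV hxV
  refine hsep (max N₁ N₂) ?_
  rw [hcyl]
  refine ⟨fun n => if n = k then U else if n = 0 then V else univ, fun n => ?_, fun n => ?_, ?_⟩
  · dsimp only
    split_ifs
    exacts [hU.measurableSet, hV.measurableSet, .univ]
  · dsimp only
    split_ifs with hn hn'
    · exact hn ▸ h₁ _ (le_max_left _ _)
    · exact hn' ▸ h₂ _ (le_max_right _ _)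
    · exact subset_univ _
  · refine eq_empty_of_forall_notMem fun y hy => ?_
    rw [mem_iInter] at hy
    have hyU := hy k
    have hyV := hy 0
    simp only [if_true] at hyU
    simp only [hk0.symm, if_false, if_true] at hyV
    exact disjoint_left.1 hUV hyU hyV

/-- **Novikov's separation theorem**: a sequence of analytic sets with empty intersection can be
enlarged to a sequence of Borel sets with empty intersection. -/
theorem seqSeparable_of_analyticSet {s : ℕ → Set α} (hs : ∀ n, AnalyticSet (s n))
    (h : ⋂ n, s n = ∅) : SeqSeparable s := by
  classical
  by_cases hne : ∃ n, s n = ∅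
  · obtain ⟨k, hk⟩ := hne
    exact SeqSeparable.of_iUnion (k := k) (u := fun i : Empty => i.elim) (by simp [hk])
      fun i => i.elim
  · push Not at hne
    have hr : ∀ n, ∃ f : (ℕ → ℕ) → α, Continuous f ∧ range f = s n := fun n => by
      have := hs n
      rw [AnalyticSet] at this
      exact this.resolve_left (hne n).ne_empty
    choose f hf hfs using hr
    simp only [← hfs] at h ⊢
    have := seqSeparable_range hf h
    simpa only [hfs] using this

end Novikov

/-! ### Projections of Borel sets with compact sections -/

section Projection

/-- A nonempty second countable space has a basis enumerated by `ℕ`. -/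
theorem exists_seq_isTopologicalBasis (G : Type*) [TopologicalSpace G]
    [SecondCountableTopology G] [Nonempty G] :
    ∃ V : ℕ → Set G, IsTopologicalBasis (range V) := by
  obtain ⟨V, hV⟩ := (countable_countableBasis G).exists_eq_range
    (nonempty_iff_ne_empty.2 fun h0 => by
      have := (isBasis_countableBasis G).sUnion_eq
      rw [h0, sUnion_empty] at this
      exact empty_ne_univ this)
  exact ⟨V, hV ▸ isBasis_countableBasis G⟩

variable {G B : Type*} [TopologicalSpace G] [PolishSpace G] [MeasurableSpace G] [BorelSpace G]
  [MeasurableSpace B] [StandardBorelSpace B]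

/-- A Borel set in a product whose sections are closed and contained in a fixed compact set has a
Borel projection. -/
theorem measurableSet_snd_image_of_isClosed [Nonempty G] {A : Set (G × B)} (hA : MeasurableSet A)
    {K : Set G} (hK : IsCompact K) (hAK : ∀ p ∈ A, p.1 ∈ K)
    (hcl : ∀ b, IsClosed {g | (g, b) ∈ A}) : MeasurableSet (Prod.snd '' A) := by
  let := upgradeStandardBorel B
  obtain ⟨V, hV⟩ := exists_seq_isTopologicalBasis G
  have hVo : ∀ n, IsOpen (V n) := fun n => hV.isOpen (mem_range_self n)
  -- As the sections are closed, the complement of `A` is the union of the rectangles `V n × (Q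
  -- n)ᶜ`. Their complements `P n`, together with `Aᶜ`, are analytic sets with empty intersection.
  let Q : ℕ → Set B := fun n => Prod.snd '' (A ∩ Prod.fst ⁻¹' V n)
  have hQ : ∀ n, AnalyticSet (Q n) := fun n =>
    (hA.inter (measurable_fst (hVo n).measurableSet)).analyticSet_image measurable_snd
  let P : ℕ → Set (G × B) := fun n => Prod.fst ⁻¹' (V n)ᶜ ∪ Prod.snd ⁻¹' Q n
  have hP : ∀ n, AnalyticSet (P n) := fun n => by
    have h1 : AnalyticSet (Prod.fst ⁻¹' (V n)ᶜ : Set (G × B)) :=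
      ((hVo n).measurableSet.compl.preimage measurable_fst).analyticSet
    have h2 : AnalyticSet (Prod.snd ⁻¹' Q n : Set (G × B)) := (hQ n).preimage continuous_snd
    simp only [P, union_eq_iUnion]
    exact AnalyticSet.iUnion fun b => by cases b <;> assumption
  have hmem : ∀ g b, (g, b) ∉ A → ∃ n, g ∈ V n ∧ b ∉ Q n := by
    intro g b hgb
    obtain ⟨_, ⟨n, rfl⟩, hgn, hn⟩ := hV.exists_subset_of_mem_open
      (show g ∈ {g | (g, b) ∈ A}ᶜ from hgb) (hcl b).isOpen_compl
    refine ⟨n, hgn, ?_⟩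
    rintro ⟨⟨g', b'⟩, ⟨h1, h2⟩, rfl⟩
    exact hn h2 h1
  let S : ℕ → Set (G × B) := fun n => Nat.casesOn n Aᶜ P
  have hS : ∀ n, AnalyticSet (S n) := by
    rintro (_ | n)
    exacts [hA.compl.analyticSet, hP n]
  obtain ⟨T, hT, hST, hT0⟩ := seqSeparable_of_analyticSet hS (by
    refine eq_empty_of_forall_notMem fun ⟨g, b⟩ hgb => ?_
    rw [mem_iInter] at hgb
    obtain ⟨n, hn1, hn2⟩ := hmem g b (hgb 0)
    rcases hgb (n + 1) with h | h
    exacts [h hn1, hn2 h])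
  -- The Borel sets `(T (n + 1))ᶜ` lie in the rectangles and still cover `Aᶜ`. Lusin separation
  -- makes the projected sides Borel as well.
  have hsep : ∀ n, ∃ D : Set B, Prod.snd '' (T (n + 1))ᶜ ⊆ D ∧ Disjoint (Q n) D ∧
      MeasurableSet D := fun n => by
    refine ((hT (n + 1)).compl.analyticSet_image measurable_snd).measurablySeparable (hQ n) ?_
    rw [disjoint_left]
    rintro _ ⟨p, hp, rfl⟩ hpQ
    exact hp (hST (n + 1) (Or.inr hpQ))
  choose D hTD hQD hD using hsep
  -- By compactness, the section over `b` is empty iff finitely many `V n` with `b ∈ D n` cover `K`;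
  -- there are countably many finite families.
  have key : (Prod.snd '' A)ᶜ =
      ⋃ F : {F : Finset ℕ // K ⊆ ⋃ n ∈ F, V n}, ⋂ n ∈ F.1, D n := by
    ext b
    simp only [mem_compl_iff, mem_iUnion, mem_iInter, Subtype.exists, exists_prop]
    constructor
    · intro hb
      have hcov : K ⊆ ⋃ n : {n // b ∈ D n}, V n := by
        intro g _
        have hgA : (g, b) ∉ A := fun h => hb ⟨_, h, rfl⟩
        have hex : ∃ n, (g, b) ∉ T n := by
          by_contra! h
          exact notMem_empty (g, b) (hT0 ▸ mem_iInter.2 h)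
        obtain ⟨n, hn⟩ := hex
        cases n with
        | zero => exact absurd (hST 0 hgA) hn
        | succ n =>
          refine mem_iUnion.2 ⟨⟨n, hTD n ⟨_, hn, rfl⟩⟩, ?_⟩
          by_contra hgV
          exact hn (hST (n + 1) (Or.inl hgV))
      obtain ⟨F, hF⟩ := hK.elim_finite_subcover (fun n : {n // b ∈ D n} => V n)
        (fun n => hVo n) hcov
      refine ⟨F.map (Function.Embedding.subtype _), fun g hg => ?_, fun n hn => ?_⟩
      · obtain ⟨n, hnF, hgn⟩ := mem_iUnion₂.1 (hF hg)
        exact mem_iUnion₂.2 ⟨n, Finset.mem_map_of_mem _ hnF, hgn⟩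
      · obtain ⟨n', -, rfl⟩ := Finset.mem_map.1 hn
        exact n'.2
    · rintro ⟨F, hF, hbF⟩ ⟨⟨g, b'⟩, hgb, rfl⟩
      obtain ⟨n, hnF, hgn⟩ := mem_iUnion₂.1 (hF (hAK _ hgb))
      exact disjoint_left.1 (hQD n) ⟨_, ⟨hgb, hgn⟩, rfl⟩ (hbF n hnF)
  rw [← compl_compl (Prod.snd '' A), key]
  exact (MeasurableSet.iUnion fun F => Finset.measurableSet_biInter _ fun n _ => hD n).compl

end Projection

/-! ### Borel sets with locally finite sections -/

section LocallyFiniteSections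

variable {G B : Type*} [TopologicalSpace G] [PolishSpace G] [LocallyCompactSpace G]
  [MeasurableSpace G] [BorelSpace G] [MeasurableSpace B] [StandardBorelSpace B]

/-- A Borel set in a product with locally finite sections has a Borel projection. -/
theorem measurableSet_snd_image_of_locFinite {A : Set (G × B)} (hA : MeasurableSet A)
    (hfin : ∀ b, LocFinite {g | (g, b) ∈ A}) : MeasurableSet (Prod.snd '' A) := by
  rcases isEmpty_or_nonempty G with hG | hG
  · rw [eq_empty_of_isEmpty A, image_empty]
    exact .empty
  have hAK : A = ⋃ n, A ∩ Prod.fst ⁻¹' compactCovering G n := by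
    rw [← inter_iUnion, ← preimage_iUnion, iUnion_compactCovering, preimage_univ, inter_univ]
  rw [hAK, image_iUnion]
  refine .iUnion fun n => ?_
  have hK := isCompact_compactCovering G n
  refine measurableSet_snd_image_of_isClosed
    (hA.inter (hK.measurableSet.preimage measurable_fst)) hK (fun p hp => hp.2) fun b => ?_
  exact (hfin b _ hK).isClosed

theorem LocFinite.mono {G : Type*} [TopologicalSpace G] {P Q : Set G} (hQ : LocFinite Q)
    (h : P ⊆ Q) : LocFinite P := fun K hK => (hQ K hK).subset (inter_subset_inter_left K h)

theorem LocFinite.countable {G : Type*} [TopologicalSpace G] [SigmaCompactSpace G] {P : Set G}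
    (hP : LocFinite P) : P.Countable := by
  have h : P = ⋃ n, P ∩ compactCovering G n := by
    rw [← inter_iUnion, iUnion_compactCovering, inter_univ]
  rw [h]
  exact countable_iUnion fun n => (hP _ (isCompact_compactCovering G n)).countable

/-- A locally finite set in a locally compact Hausdorff space is discrete. -/
theorem LocFinite.exists_isOpen {G : Type*} [TopologicalSpace G] [LocallyCompactSpace G]
    [T2Space G] {P : Set G} (hP : LocFinite P) (g : G) :
    ∃ U, IsOpen U ∧ g ∈ U ∧ ∀ h ∈ P, h ∈ U → h = g := by
  obtain ⟨K, hK, hgK⟩ := exists_compact_mem_nhds g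
  have hfin : ((P ∩ K) \ {g}).Finite := (hP K hK).subset sdiff_subset
  refine ⟨interior K \ ((P ∩ K) \ {g}), isOpen_interior.sdiff hfin.isClosed,
    ⟨mem_interior_iff_mem_nhds.2 hgK, fun h => h.2 rfl⟩, fun h hh hU => ?_⟩
  by_contra hne
  exact hU.2 ⟨⟨hh, interior_subset hU.1⟩, hne⟩

/-- A Borel set in a product with locally finite sections is a countable disjoint union of Borel
graphs of partial functions. -/
theorem exists_partition_graphs {A : Set (G × B)} (hA : MeasurableSet A)
    (hfin : ∀ b, LocFinite {g | (g, b) ∈ A}) :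
    ∃ E : ℕ → Set (G × B), (∀ n, MeasurableSet (E n)) ∧ Pairwise (Function.onFun Disjoint E) ∧
      ⋃ n, E n = A ∧ ∀ n, InjOn Prod.snd (E n) := by
  rcases isEmpty_or_nonempty G with hG | hG
  · exact ⟨fun _ => ∅, fun _ => .empty, fun _ _ _ => by simp [Function.onFun],
      by simp [eq_empty_of_isEmpty A], fun _ => injOn_empty _⟩
  obtain ⟨V, hV⟩ := exists_seq_isTopologicalBasis G
  have hVo : ∀ n, IsOpen (V n) := fun n => hV.isOpen (mem_range_self n)
  let Q : ℕ → ℕ → Set B := fun k i =>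
    Prod.snd '' (A ∩ Prod.fst ⁻¹' V k ∩ Prod.fst ⁻¹' V i)
  have hQ : ∀ k i, MeasurableSet (Q k i) := fun k i => by
    refine measurableSet_snd_image_of_locFinite
      ((hA.inter (measurable_fst (hVo k).measurableSet)).inter
        (measurable_fst (hVo i).measurableSet)) fun b => (hfin b).mono fun g hg => hg.1.1
  -- `D k` is the set of `b` whose section has at least two points in `V k`, detected by disjoint
  -- basic open sets. Outside it, `A` restricted to `V k` is a graph, and discreteness of the
  -- sections makes these graphs cover `A`.
  let D : ℕ → Set B := fun k => ⋃ i, ⋃ j, ⋃ _ : Disjoint (V i) (V j), Q k i ∩ Q k j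
  have hD : ∀ k, MeasurableSet (D k) := fun k =>
    .iUnion fun i => .iUnion fun j => .iUnion fun _ => (hQ k i).inter (hQ k j)
  let E : ℕ → Set (G × B) := fun k => (A ∩ Prod.fst ⁻¹' V k) \ Prod.snd ⁻¹' D k
  have hE : ∀ k, MeasurableSet (E k) := fun k =>
    (hA.inter (measurable_fst (hVo k).measurableSet)).diff (measurable_snd (hD k))
  refine ⟨disjointed E, fun n => .disjointed hE n, disjoint_disjointed E, ?_, fun n => ?_⟩
  · rw [iUnion_disjointed]
    refine subset_antisymm (iUnion_subset fun k p hp => hp.1.1) ?_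
    rintro ⟨g, b⟩ hgb
    obtain ⟨U, hU, hgU, hUuniq⟩ := (hfin b).exists_isOpen g
    obtain ⟨_, ⟨k, rfl⟩, hgk, hkU⟩ := hV.exists_subset_of_mem_open hgU hU
    refine mem_iUnion.2 ⟨k, ⟨hgb, hgk⟩, fun hbD => ?_⟩
    simp only [D, mem_preimage, mem_iUnion] at hbD
    obtain ⟨i, j, hij, ⟨⟨g₁, _⟩, h₁, rfl⟩, ⟨⟨g₂, b₂⟩, h₂, hb₂⟩⟩ := hbD
    simp only at hb₂
    subst hb₂
    have e₁ := hUuniq g₁ h₁.1.1 (hkU h₁.1.2)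
    have e₂ := hUuniq g₂ h₂.1.1 (hkU h₂.1.2)
    subst e₁
    subst e₂
    exact disjoint_left.1 hij h₁.2 h₂.2
  · refine InjOn.mono (disjointed_subset E n) ?_
    rintro ⟨g₁, b⟩ h₁ ⟨g₂, b₂⟩ h₂ hb
    simp only at hb
    subst hb
    by_contra hne
    have hne' : g₁ ≠ g₂ := fun h => hne (by rw [h])
    obtain ⟨U₁, U₂, hU₁, hU₂, hg₁, hg₂, hU⟩ := t2_separation hne'
    obtain ⟨_, ⟨i, rfl⟩, hgi, hi⟩ := hV.exists_subset_of_mem_open hg₁ hU₁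
    obtain ⟨_, ⟨j, rfl⟩, hgj, hj⟩ := hV.exists_subset_of_mem_open hg₂ hU₂
    refine h₁.2 ?_
    simp only [D, mem_preimage, mem_iUnion]
    exact ⟨i, j, hU.mono hi hj, ⟨_, ⟨h₁.1, hgi⟩, rfl⟩, ⟨_, ⟨h₂.1, hgj⟩, rfl⟩⟩

/-- Summing a Borel function over the locally finite sections of a Borel set yields a Borel
function. -/
theorem measurable_tsum_section {A : Set (G × B)} (hA : MeasurableSet A)
    (hfin : ∀ b, LocFinite {g | (g, b) ∈ A}) {F : G → B → ℝ≥0∞}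
    (hF : Measurable (Function.uncurry F)) :
    Measurable fun b => ∑' g : {g | (g, b) ∈ A}, F g b := by
  obtain ⟨E, hE, hdisj, rfl, hinj⟩ := exists_partition_graphs hA hfin
  have h1 : ∀ b, ∑' g : {g | (g, b) ∈ ⋃ n, E n}, F g b =
      ∑' n, ∑' g : G, (E n).indicator (Function.uncurry F) (g, b) := by
    intro b
    rw [ENNReal.tsum_comm, tsum_subtype {g | (g, b) ∈ ⋃ n, E n} fun g => F g b]
    refine tsum_congr fun g => ?_
    by_cases hg : (g, b) ∈ ⋃ n, E n
    · rw [indicator_of_mem (by exact hg)]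
      obtain ⟨n, hn⟩ := mem_iUnion.1 hg
      rw [tsum_eq_single n, indicator_of_mem hn, Function.uncurry_apply_pair]
      intro k hk
      exact indicator_of_notMem (fun h => disjoint_left.1 (hdisj hk) h hn) _
    · rw [indicator_of_notMem (by exact hg)]
      rw [mem_iUnion, not_exists] at hg
      simp [hg]
  simp only [h1]
  refine Measurable.tsum fun n => ?_
  have : StandardBorelSpace (E n) := (hE n).standardBorel
  have hemb : MeasurableEmbedding fun p : E n => p.1.2 :=
    (measurable_snd.comp measurable_subtype_coe).measurableEmbedding
      fun p q hpq => Subtype.ext (hinj n p.2 q.2 hpq)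
  -- Over each `b` the graph `E n` has at most one point, so the sum is an extension by zero along
  -- an injective Borel map.
  have h2 : (fun b => ∑' g : G, (E n).indicator (Function.uncurry F) (g, b)) =
      Function.extend (fun p : E n => p.1.2) (fun p : E n => Function.uncurry F p.1) 0 := by
    funext b
    by_cases hb : ∃ p : E n, p.1.2 = b
    · obtain ⟨p, rfl⟩ := hb
      rw [hemb.injective.extend_apply, tsum_eq_single p.1.1]
      · exact indicator_of_mem p.2 _
      · intro g hg
        refine indicator_of_notMem (fun h => hg ?_) _
        exact congrArg Prod.fst (hinj n h p.2 rfl)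
    · rw [Function.extend_apply' _ _ _ hb, Pi.zero_apply, ENNReal.tsum_eq_zero]
      exact fun g => indicator_of_notMem (fun h => hb ⟨⟨_, h⟩, rfl⟩) _
  rw [h2]
  exact hemb.measurable_extend (hF.comp measurable_subtype_coe) measurable_zero

/-- A Borel set with locally finite sections admits a Borel uniformization. -/
theorem exists_measurable_tsum_eq_one {A : Set (G × B)} (hA : MeasurableSet A)
    (hfin : ∀ b, LocFinite {g | (g, b) ∈ A}) :
    ∃ c : G → B → ℝ≥0∞, Measurable (Function.uncurry c) ∧
      ∀ b, {g | (g, b) ∈ A}.Nonempty → ∑' g : {g | (g, b) ∈ A}, c g b = 1 := by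
  classical
  obtain ⟨E, hE, hdisj, rfl, hinj⟩ := exists_partition_graphs hA hfin
  have hsnd : ∀ n, MeasurableSet (Prod.snd '' E n) := fun n =>
    (hE n).image_of_measurable_injOn measurable_snd (hinj n)
  -- Over each `b`, `C` keeps only the point on the first graph that reaches `b`.
  let C : Set (G × B) := ⋃ n, E n \ ⋃ m : Fin n, Prod.snd ⁻¹' (Prod.snd '' E m)
  have hC : MeasurableSet C := .iUnion fun n =>
    (hE n).diff (.iUnion fun m => measurable_snd (hsnd m))
  refine ⟨fun g b => C.indicator 1 (g, b), measurable_one.indicator hC, ?_⟩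
  rintro b ⟨g, hg⟩
  have hex : ∃ n, b ∈ Prod.snd '' E n := by
    obtain ⟨n, hn⟩ := mem_iUnion.1 hg
    exact ⟨n, _, hn, rfl⟩
  obtain ⟨⟨g₀, _⟩, hg₀, rfl⟩ := Nat.find_spec hex
  set b := (g₀, ‹B›).2
  have hmin : ∀ m < Nat.find hex, b ∉ Prod.snd '' E m := fun m hm => Nat.find_min hex hm
  have hCmem : ∀ g, (g, b) ∈ C ↔ g = g₀ := by
    intro g
    constructor
    · intro h
      obtain ⟨n, hn, hn'⟩ := mem_iUnion.1 h
      have hle : n ≤ Nat.find hex := by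
        by_contra! hlt
        exact hn' (mem_iUnion.2 ⟨⟨_, hlt⟩, _, hg₀, rfl⟩)
      have hge : Nat.find hex ≤ n := Nat.find_min' hex ⟨_, hn, rfl⟩
      obtain rfl := le_antisymm hle hge
      exact congrArg Prod.fst (hinj _ hn hg₀ rfl)
    · rintro rfl
      refine mem_iUnion.2 ⟨_, hg₀, fun h => ?_⟩
      obtain ⟨m, hm⟩ := mem_iUnion.1 h
      exact hmin m m.2 hm
  rw [tsum_eq_single (⟨g₀, mem_iUnion.2 ⟨_, hg₀⟩⟩ : {g | (g, b) ∈ ⋃ n, E n})]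
  · exact indicator_of_mem ((hCmem g₀).2 rfl) _
  · intro g hgne
    exact indicator_of_notMem (fun h => hgne (Subtype.ext ((hCmem g).1 h))) _

/-- A Borel set with locally finite sections carries a positive Borel function with sums at most
`1` along the sections. -/
theorem exists_measurable_pos_tsum_le_one {A : Set (G × B)} (hA : MeasurableSet A)
    (hfin : ∀ b, LocFinite {g | (g, b) ∈ A}) :
    ∃ q : G → B → ℝ≥0∞, Measurable (Function.uncurry q) ∧ (∀ g b, 0 < q g b) ∧
      ∀ b, ∑' g : {g | (g, b) ∈ A}, q g b ≤ 1 := by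
  obtain ⟨E, hE, hdisj, hEA, hinj⟩ := exists_partition_graphs hA hfin
  -- Each graph contributes at most `2⁻¹ ^ (n + 1)` over a given point. The value `1` off `A` only
  -- secures positivity everywhere.
  let r : ℕ → G × B → ℝ≥0∞ := fun n => (E n).indicator fun _ => 2⁻¹ ^ (n + 1)
  have hr : ∀ n, Measurable (r n) := fun n => measurable_const.indicator (hE n)
  refine ⟨fun g b => Aᶜ.indicator 1 (g, b) + ∑' n, r n (g, b),
    (measurable_one.indicator hA.compl).add (.tsum hr), fun g b => ?_, fun b => ?_⟩
  · by_cases h : (g, b) ∈ A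
    · obtain ⟨n, hn⟩ := mem_iUnion.1 (hEA ▸ h)
      refine lt_of_lt_of_le ?_ (le_add_left (ENNReal.le_tsum n))
      simp only [r, indicator_of_mem hn]
      exact ENNReal.pow_pos (by simp) _
    · dsimp only
      rw [indicator_of_mem (s := Aᶜ) h]
      exact lt_of_lt_of_le one_pos le_self_add
  · calc ∑' g : {g | (g, b) ∈ A}, (Aᶜ.indicator 1 ((g : G), b) + ∑' n, r n (g, b))
        = ∑' g : {g | (g, b) ∈ A}, ∑' n, r n (g, b) := by
          refine tsum_congr fun g => ?_
          rw [indicator_of_notMem (s := Aᶜ) (fun h => h g.2), zero_add]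
      _ = ∑' n, ∑' g : {g | (g, b) ∈ A}, r n (g, b) := ENNReal.tsum_comm
      _ ≤ ∑' n : ℕ, (2⁻¹ : ℝ≥0∞) ^ (n + 1) := by
          refine ENNReal.tsum_le_tsum fun n => ?_
          by_cases h : ∃ g : {g | (g, b) ∈ A}, ((g : G), b) ∈ E n
          · obtain ⟨g, hg⟩ := h
            rw [tsum_eq_single g]
            · simp [r, hg]
            · intro g' hg'
              refine indicator_of_notMem (fun h => hg' (Subtype.ext ?_)) _
              exact congrArg Prod.fst (hinj n h hg rfl)
          · push Not at h
            simp [r, h]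
      _ = 1 := by
          rw [ENNReal.tsum_geometric_add_one, ENNReal.one_sub_inv_two, inv_inv]
          exact ENNReal.inv_mul_cancel (by simp) (by simp)

end LocallyFiniteSections

/-! ### Polishness and inversion invariance -/

section Group

variable {G : Type*} [Group G] [TopologicalSpace G] [IsTopologicalGroup G]
  [LocallyCompactSpace G] [SecondCountableTopology G]

-- The right uniformity is complete by local compactness and countably generated by first
-- countability.
variable (G) in
theorem polishSpace_of_locallyCompact_group [T2Space G] : PolishSpace G := by
  let := IsTopologicalGroup.rightUniformSpace G
  have : IsRightUniformGroup G := ⟨rfl⟩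
  have : CompleteSpace G := IsRightUniformGroup.completeSpace_of_weaklyLocallyCompactSpace
  have : (uniformity G).IsCountablyGenerated := Filter.comap.isCountablyGenerated _ _
  infer_instance

variable [MeasurableSpace G] [BorelSpace G]

/-- Right invariance makes `m.inv` left invariant, so it is `c • m`; inverting twice gives `c ^ 2 =
1`. -/
theorem isInvInvariant_of_unimodular (m : Measure G) [m.IsHaarMeasure] [m.IsMulRightInvariant] :
    m.IsInvInvariant := by
  constructor
  let c : ℝ≥0∞ := m.inv.haarScalarFactor m
  have hc : m.inv = c • m := Measure.isMulLeftInvariant_eq_smul m.inv m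
  have : (m.map Inv.inv).map Inv.inv = c ^ 2 • m := by
    rw [← Measure.inv_def m, hc, Measure.map_smul, ← Measure.inv_def m, hc, smul_smul, pow_two]
  have hm : m = c ^ 2 • m := by
    rw [Measure.map_map measurable_inv measurable_inv] at this
    simpa only [inv_involutive, Function.Involutive.comp_self, Measure.map_id]
  have K : PositiveCompacts G := Classical.arbitrary _
  have : c ^ 2 * m K = 1 ^ 2 * m K := by
    conv_rhs => rw [hm]
    simp
  have : c ^ 2 = 1 ^ 2 :=
    (ENNReal.mul_left_inj (Measure.measure_pos_of_nonempty_interior m K.interior_nonempty).ne'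
      K.isCompact.measure_lt_top.ne).1 this
  have : c = 1 := (ENNReal.pow_right_strictMono two_ne_zero).injective this
  rw [hc, this, one_smul]

end Group

theorem returnTimes_smul_iff {G Z : Type*} [Group G] [MulAction G Z] (S : Set Z) (k g : G) (z : Z) :
    g ∈ returnTimes G S (k • z) ↔ g * k ∈ returnTimes G S z := by
  simp [returnTimes, mul_smul]

/-- Return times sets satisfy `S_{k.z} = S_z k⁻¹`. -/
theorem tsum_returnTimes_smul {G Z : Type*} [Group G] [MulAction G Z] (S : Set Z) (k : G) (z : Z)
    (φ : G → ℝ≥0∞) :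
    ∑' g : returnTimes G S (k • z), φ g = ∑' g : returnTimes G S z, φ (g * k⁻¹) :=
  ((Equiv.subtypeEquiv (Equiv.mulRight k⁻¹) (fun g => by
      change g ∈ returnTimes G S z ↔ g * k⁻¹ ∈ returnTimes G S (k • z)
      rw [returnTimes_smul_iff, inv_mul_cancel_right])).tsum_eq
    (fun g : returnTimes G S (k • z) => φ g)).symm

/-- A measure with respect to which some positive function is integrable is `σ`-finite. -/
theorem sigmaFinite_of_lintegral_lt_top {Z : Type*} [MeasurableSpace Z] {ν : Measure Z}
    {φ : Z → ℝ≥0∞} (hφ : Measurable φ) (hpos : ∀ z, 0 < φ z) (hfin : ∫⁻ z, φ z ∂ν < ∞) :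
    SigmaFinite ν := by
  rw [← withDensity_inv_same hφ (.of_forall fun z => (hpos z).ne')
    ((ae_lt_top hφ hfin.ne).mono fun z hz => hz.ne)]
  have : IsFiniteMeasure (ν.withDensity φ) := isFiniteMeasure_withDensity hfin.ne
  exact SigmaFinite.withDensity_of_ne_top' fun z => ENNReal.inv_ne_top.2 (hpos z).ne'

/-! ### Transverse measures of invariant measures -/

section TransverseMeasure

variable {G Z : Type*} [Group G] [TopologicalSpace G] [IsTopologicalGroup G]
  [LocallyCompactSpace G] [T2Space G] [MeasurableSpace G] [BorelSpace G]

theorem lintegral_weight_mul_left (m : Measure G) [m.IsHaarMeasure] (h : G) :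
    ∫⁻ g, weight m (h * g) ∂m = 1 := by
  rw [lintegral_mul_left_eq_self, lintegral_weight]

variable [SecondCountableTopology G]

theorem lintegral_weight_mul_inv (m : Measure G) [m.IsHaarMeasure] [m.IsMulRightInvariant]
    (g : G) : ∫⁻ k, weight m (g * k⁻¹) ∂m = 1 := by
  have := isInvInvariant_of_unimodular m
  rw [lintegral_inv_eq_self (fun k => weight m (g * k)), lintegral_weight_mul_left]

variable [MeasurableSpace Z] [MulAction G Z] [MeasurableSMul₂ G Z] {S : Set Z}

/-- Summing a Borel function over locally finite return times sets yields a Borel function. -/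
theorem measurable_tsum_returnTimes (hS : MeasurableSet S)
    (hfin : ∀ z, LocFinite (returnTimes G S z)) {P : Type*} [MeasurableSpace P]
    [StandardBorelSpace P] {π : P → Z} (hπ : Measurable π) {F : G → P → ℝ≥0∞}
    (hF : Measurable (Function.uncurry F)) :
    Measurable fun p => ∑' g : returnTimes G S (π p), F g p := by
  have := polishSpace_of_locallyCompact_group G
  exact measurable_tsum_section (A := {q : G × P | q.1 • π q.2 ∈ S})
    ((measurable_fst.smul (hπ.comp measurable_snd)) hS) (fun p => hfin (π p)) hF

variable [StandardBorelSpace Z]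

theorem measurable_transverseKernel (m : Measure G) (hS : MeasurableSet S)
    (hfin : ∀ z, LocFinite (returnTimes G S z)) :
    Measurable fun z => Measure.sum fun g : returnTimes G S z =>
      weight m (g : G) • Measure.dirac (⟨(g : G) • z, g.2⟩ : S) := by
  refine Measure.measurable_of_measurable_coe _ ?_
  rintro _ ⟨t, ht, rfl⟩
  have h : ∀ z, (Measure.sum fun g : returnTimes G S z =>
      weight m (g : G) • Measure.dirac (⟨(g : G) • z, g.2⟩ : S)) (Subtype.val ⁻¹' t) =
      ∑' g : returnTimes G S z, weight m g * t.indicator 1 ((g : G) • z) := by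
    intro z
    rw [Measure.sum_apply _ (measurable_subtype_coe ht)]
    refine tsum_congr fun g => ?_
    rw [Measure.smul_apply, Measure.dirac_apply' _ (measurable_subtype_coe ht), smul_eq_mul]
    rfl
  simp only [h]
  refine measurable_tsum_returnTimes hS hfin measurable_id
    (F := fun g z => weight m g * t.indicator 1 (g • z)) ?_
  exact ((measurable_weight m).comp measurable_fst).mul
    ((measurable_one.indicator ht).comp measurable_smul)

theorem lintegral_transverseMeasure (m : Measure G) (ν : Measure Z) (hS : MeasurableSet S)
    (hfin : ∀ z, LocFinite (returnTimes G S z)) {f : Z → ℝ≥0∞} (hf : Measurable f) :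
    ∫⁻ y, f y ∂(transverseMeasure m ν S) =
      ∫⁻ z, ∑' g : returnTimes G S z, weight m g * f ((g : G) • z) ∂ν := by
  have hf' : Measurable fun y : S => f y := hf.comp measurable_subtype_coe
  rw [transverseMeasure, Measure.lintegral_bind (measurable_transverseKernel m hS hfin).aemeasurable
    hf'.aemeasurable]
  refine lintegral_congr fun z => ?_
  rw [lintegral_sum_measure]
  refine tsum_congr fun g => ?_
  rw [lintegral_smul_measure, lintegral_dirac' _ hf', smul_eq_mul]

variable (m : Measure G) [m.IsHaarMeasure] [m.IsMulRightInvariant]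

/-- The defining identity of the transverse measure: the measure on `G × S` obtained by summing
over return times is the product of the Haar measure and the transverse measure. -/
theorem lintegral_tsum_returnTimes (ν : Measure Z) [SFinite ν] [SMulInvariantMeasure G Z ν]
    (hS : MeasurableSet S) (hfin : ∀ z, LocFinite (returnTimes G S z)) {F : G → Z → ℝ≥0∞}
    (hF : Measurable (Function.uncurry F)) :
    ∫⁻ z, ∑' g : returnTimes G S z, F g ((g : G) • z) ∂ν =
      ∫⁻ y, ∫⁻ g, F g y ∂m ∂(transverseMeasure m ν S) := by
  have := polishSpace_of_locallyCompact_group G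
  have hcount : ∀ z, Countable (returnTimes G S z) := fun z => (hfin z).countable.to_subtype
  have hFg : ∀ (g : G) (z : Z) , Measurable fun k => F k z := fun g z =>
    hF.comp measurable_prodMk_right
  have hw := measurable_weight m
  symm
  calc ∫⁻ y, ∫⁻ g, F g y ∂m ∂(transverseMeasure m ν S)
      = ∫⁻ z, ∑' g : returnTimes G S z, weight m g * ∫⁻ k, F k ((g : G) • z) ∂m ∂ν :=
        lintegral_transverseMeasure m ν hS hfin (f := fun y => ∫⁻ g, F g y ∂m)
          (Measurable.lintegral_prod_left' hF)
    _ = ∫⁻ z, ∫⁻ k, ∑' g : returnTimes G S z, weight m g * F (g * k) ((g : G) • z) ∂m ∂ν := by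
        refine lintegral_congr fun z => ?_
        rw [lintegral_tsum fun g => ?_]
        · refine tsum_congr fun g => ?_
          rw [lintegral_const_mul]
          · rw [lintegral_mul_left_eq_self (μ := m) (fun k => F k ((g : G) • z))]
          · exact (hFg 1 _).comp (measurable_const_mul _)
        · exact (((hFg 1 _).comp (measurable_const_mul _)).const_mul _).aemeasurable
    _ = ∫⁻ k, ∫⁻ z, ∑' g : returnTimes G S z, weight m g * F (g * k) ((g : G) • z) ∂ν ∂m := by
        refine lintegral_lintegral_swap (Measurable.aemeasurable ?_)
        refine measurable_tsum_returnTimes hS hfin (π := fun p : Z × G => p.1) measurable_fst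
          (F := fun g p => weight m g * F (g * p.2) (g • p.1)) ?_
        refine (hw.comp measurable_fst).mul (hF.comp (Measurable.prodMk ?_ ?_))
        · exact measurable_fst.mul (measurable_snd.comp measurable_snd)
        · exact measurable_fst.smul (measurable_fst.comp measurable_snd)
    _ = ∫⁻ k, ∫⁻ z, ∑' g : returnTimes G S z,
          weight m (g * k⁻¹) * F g ((g : G) • z) ∂ν ∂m := by
        refine lintegral_congr fun k => ?_
        -- Replace `z` by `k.z`. A return time of `k.z` has the form `g k⁻¹` with `g` a return time
        -- of `z`, which moves `k` out of `F` into the weight.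
        rw [← (measurePreserving_smul k ν).lintegral_comp_emb (measurableEmbedding_const_smul k)]
        refine lintegral_congr fun z => ?_
        rw [tsum_returnTimes_smul S k z fun g => weight m g * F (g * k) (g • k • z)]
        refine tsum_congr fun g => ?_
        rw [inv_mul_cancel_right, ← mul_smul, inv_mul_cancel_right]
    _ = ∫⁻ z, ∫⁻ k, ∑' g : returnTimes G S z,
          weight m (g * k⁻¹) * F g ((g : G) • z) ∂m ∂ν := by
        refine (lintegral_lintegral_swap (Measurable.aemeasurable ?_)).symm
        refine measurable_tsum_returnTimes hS hfin (π := fun p : Z × G => p.1) measurable_fst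
          (F := fun g p => weight m (g * p.2⁻¹) * F g (g • p.1)) ?_
        refine (hw.comp ?_).mul (hF.comp (Measurable.prodMk measurable_fst ?_))
        · exact measurable_fst.mul (measurable_snd.comp measurable_snd).inv
        · exact measurable_fst.smul (measurable_fst.comp measurable_snd)
    _ = ∫⁻ z, ∑' g : returnTimes G S z, F g ((g : G) • z) ∂ν := by
        refine lintegral_congr fun z => ?_
        have hwi : ∀ g : G, Measurable fun k => weight m (g * k⁻¹) := fun g =>
          hw.comp (measurable_inv.const_mul g)
        rw [lintegral_tsum (f := fun (g : returnTimes G S z) k =>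
            weight m (g * k⁻¹) * F g ((g : G) • z))
          fun g => ((hwi g).mul_const _).aemeasurable]
        refine tsum_congr fun g => ?_
        rw [lintegral_mul_const _ (hwi g), lintegral_weight_mul_inv, one_mul]

/-- The transverse measure does not depend on the weight. -/
theorem lintegral_tsum_returnTimes_weight (ν : Measure Z) [SFinite ν] [SMulInvariantMeasure G Z ν]
    (hS : MeasurableSet S) (hfin : ∀ z, LocFinite (returnTimes G S z)) {w : G → ℝ≥0∞}
    (hw : Measurable w) (hw1 : ∫⁻ g, w g ∂m = 1) {f : Z → ℝ≥0∞} (hf : Measurable f) :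
    ∫⁻ z, ∑' g : returnTimes G S z, w g * f ((g : G) • z) ∂ν =
      ∫⁻ y, f y ∂(transverseMeasure m ν S) := by
  rw [lintegral_tsum_returnTimes m ν hS hfin (F := fun g z => w g * f z)
    ((hw.comp measurable_fst).mul (hf.comp measurable_snd))]
  refine lintegral_congr fun y => ?_
  rw [lintegral_mul_const _ hw, hw1, one_mul]

/-- Multiply a positive `ν`-integrable `p` by a positive `q` whose sums over return times are at
most `1`. The main identity converts this product into a positive function integrable for the
transverse measure. -/
theorem sigmaFinite_transverseMeasure (ν : Measure Z) [SigmaFinite ν] [SMulInvariantMeasure G Z ν]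
    (hS : MeasurableSet S) (hfin : ∀ z, LocFinite (returnTimes G S z)) :
    SigmaFinite (transverseMeasure m ν S) := by
  have := polishSpace_of_locallyCompact_group G
  obtain ⟨p, hp0, hp, hpfin⟩ := exists_pos_lintegral_lt_of_sigmaFinite ν one_ne_zero
  obtain ⟨q, hq, hq0, hq1⟩ := exists_measurable_pos_tsum_le_one
    (A := {x : G × Z | x.1 • x.2 ∈ S}) (measurable_smul hS) hfin
  let F : G → Z → ℝ≥0∞ := fun g y => p (g⁻¹ • y) * q g (g⁻¹ • y)
  have hsm : Measurable fun x : G × Z => x.1⁻¹ • x.2 := measurable_fst.inv.smul measurable_snd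
  have hF : Measurable (Function.uncurry F) :=
    (hp.coe_nnreal_ennreal.comp hsm).mul (hq.comp (measurable_fst.prodMk hsm))
  have hφ : Measurable fun y => ∫⁻ g, F g y ∂m := Measurable.lintegral_prod_left' hF
  refine sigmaFinite_of_lintegral_lt_top (hφ.comp measurable_subtype_coe) (fun y => ?_) ?_
  · have hFy : Measurable fun g => F g y := hF.comp measurable_prodMk_right
    rw [Function.comp_apply, lintegral_pos_iff_support hFy]
    have hsupp : Function.support (fun g => F g y) = univ := by
      refine eq_univ_of_forall fun g => ?_
      exact mul_ne_zero (ENNReal.coe_ne_zero.2 (hp0 _).ne') (hq0 _ _).ne'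
    rw [hsupp]
    exact isOpen_univ.measure_pos m univ_nonempty
  · have := lintegral_tsum_returnTimes m ν hS hfin hF
    simp only [Function.comp_def]
    rw [← this]
    refine lt_of_le_of_lt (lintegral_mono fun z => ?_) (hpfin.trans ENNReal.one_lt_top)
    simp only [F, inv_smul_smul]
    rw [ENNReal.tsum_mul_left]
    exact mul_le_of_le_one_right' (hq1 z)

/-- An invariant measure is determined by its transverse measure on a cross section. -/
theorem eq_of_transverseMeasure_eq (ν₁ ν₂ : Measure Z) [SFinite ν₁] [SFinite ν₂]
    [SMulInvariantMeasure G Z ν₁] [SMulInvariantMeasure G Z ν₂]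
    (hS : MeasurableSet S) (hfin : ∀ z, LocFinite (returnTimes G S z))
    (hne₁ : ∀ᵐ z ∂ν₁, (returnTimes G S z).Nonempty)
    (hne₂ : ∀ᵐ z ∂ν₂, (returnTimes G S z).Nonempty)
    (h : transverseMeasure m ν₁ S = transverseMeasure m ν₂ S) : ν₁ = ν₂ := by
  have := polishSpace_of_locallyCompact_group G
  obtain ⟨c, hc, hc1⟩ := exists_measurable_tsum_eq_one
    (A := {x : G × Z | x.1 • x.2 ∈ S}) (measurable_smul hS) hfin
  ext t ht
  -- Chosen so that `F g (g • z) = c g z * t.indicator 1 z`. As `c` sums to `1` over nonempty return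
  -- times sets, summing `F` recovers the indicator of `t` almost everywhere.
  let F : G → Z → ℝ≥0∞ := fun g y => c g (g⁻¹ • y) * t.indicator 1 (g⁻¹ • y)
  have hsm : Measurable fun x : G × Z => x.1⁻¹ • x.2 := measurable_fst.inv.smul measurable_snd
  have hF : Measurable (Function.uncurry F) :=
    (hc.comp (measurable_fst.prodMk hsm)).mul ((measurable_one.indicator ht).comp hsm)
  have key : ∀ ν : Measure Z, (∀ᵐ z ∂ν, (returnTimes G S z).Nonempty) →
      ν t = ∫⁻ z, ∑' g : returnTimes G S z, F g ((g : G) • z) ∂ν := by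
    intro ν hν
    rw [← lintegral_indicator_one ht]
    refine lintegral_congr_ae (hν.mono fun z hz => ?_)
    simp only [F, inv_smul_smul]
    rw [ENNReal.tsum_mul_right]
    have h1 : ∑' g : returnTimes G S z, c g z = 1 := hc1 z hz
    rw [h1, one_mul]
  rw [key ν₁ hne₁, key ν₂ hne₂, lintegral_tsum_returnTimes m ν₁ hS hfin hF,
    lintegral_tsum_returnTimes m ν₂ hS hfin hF, h]

end TransverseMeasure

/-! ### Return times in intersection spaces -/

section Spaces

variable {G X : Type*} [Group G] [MulAction G X]

theorem mem_intersectionSpace_iff {Y : Set X} {r : ℕ} {x : Fin r → X} :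
    x ∈ intersectionSpace G Y r ↔ ∃ g : G, ∀ i, g • x i ∈ Y := by
  constructor
  · rintro ⟨g, y, hy, rfl⟩
    exact ⟨g⁻¹, fun i => by simpa using hy i⟩
  · rintro ⟨g, hg⟩
    exact ⟨g⁻¹, g • x, hg, by simp⟩

theorem returnTimes_powerSection (Y : Set X) (r : ℕ) (z : intersectionSpace G Y r) :
    returnTimes G (powerSection G Y r) z = returnTimes G (univ.pi fun _ => Y) (z : Fin r → X) := by
  ext g
  simp [returnTimes, powerSection]

theorem returnTimes_powerSection_nonempty (Y : Set X) (r : ℕ) (z : intersectionSpace G Y r) :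
    (returnTimes G (powerSection G Y r) z).Nonempty := by
  obtain ⟨g, hg⟩ := mem_intersectionSpace_iff.1 z.2
  exact ⟨g, hg⟩

theorem mem_returnTimes_intersectionSection {Y : Set X} {s : ℕ} {p : ExtendedSpace G Y s} {g : G} :
    g ∈ returnTimes G (intersectionSection G Y s) p ↔
      ∃ h : G, (h * g) • p.1 ∈ Y ∧ ∀ i, h • (p.2 : Fin s → X) i ∈ Y := by
  change Fin.cons (g • p.1) (p.2 : Fin s → X) ∈ intersectionSpace G Y (s + 1) ↔ _
  simp [mem_intersectionSpace_iff, Fin.forall_fin_succ, mul_smul]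

theorem returnTimes_intersectionSection_nonempty {Y : Set X} {s : ℕ} (p : ExtendedSpace G Y s)
    (hp : (returnTimes G Y p.1).Nonempty) :
    (returnTimes G (intersectionSection G Y s) p).Nonempty := by
  obtain ⟨k, hk⟩ := hp
  obtain ⟨h, hh⟩ := mem_intersectionSpace_iff.1 p.2.2
  exact ⟨h⁻¹ * k, mem_returnTimes_intersectionSection.2 ⟨h, by rwa [mul_inv_cancel_left], hh⟩⟩

variable [TopologicalSpace G]

theorem locFinite_returnTimes_pi {Y : Set X} (hY : ∀ x, LocFinite (returnTimes G Y x)) {r : ℕ}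
    (hr : 1 ≤ r) (x : Fin r → X) : LocFinite (returnTimes G (univ.pi fun _ => Y) x) :=
  (hY (x ⟨0, hr⟩)).mono fun _ hg => hg ⟨0, hr⟩ (mem_univ _)

theorem locFinite_returnTimes_powerSection {Y : Set X} (hY : ∀ x, LocFinite (returnTimes G Y x))
    {r : ℕ} (hr : 1 ≤ r) (z : intersectionSpace G Y r) :
    LocFinite (returnTimes G (powerSection G Y r) z) := by
  rw [returnTimes_powerSection]
  exact locFinite_returnTimes_pi hY hr _

/-- Write `g = h⁻¹ (h g)`, where `h` sends the first coordinate of `z` into `Y` and `h g` sends `x`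
into `Y`. A first coordinate exists because `1 ≤ s`. -/
theorem locFinite_returnTimes_intersectionSection {Y : Set X}
    (hstar : ∀ x₁ x₂ : X, LocFinite ((returnTimes G Y x₁)⁻¹ * returnTimes G Y x₂)) {s : ℕ}
    (hs : 1 ≤ s) (p : ExtendedSpace G Y s) :
    LocFinite (returnTimes G (intersectionSection G Y s) p) := by
  refine (hstar ((p.2 : Fin s → X) ⟨0, hs⟩) p.1).mono fun g hg => ?_
  obtain ⟨h, hh, hz⟩ := mem_returnTimes_intersectionSection.1 hg
  exact ⟨h⁻¹, inv_mem_inv.2 (hz _), h * g, hh, by simp⟩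

end Spaces

/-! ### Borel structure of the intersection spaces -/

section Measurability

variable {G X : Type*} [Group G] [MulAction G X] [MeasurableSpace X]

theorem measurableSet_powerSection {Y : Set X} (hY : MeasurableSet Y) (r : ℕ) :
    MeasurableSet (powerSection G Y r) := by
  have : powerSection G Y r = Subtype.val ⁻¹' (univ.pi fun _ => Y) := by
    ext z
    simp [powerSection]
  rw [this]
  exact measurable_subtype_coe (.univ_pi fun _ => hY)

theorem measurable_concat (Y : Set X) (s : ℕ) : Measurable (concat G Y s) := by
  refine measurable_pi_iff.2 fun i => ?_
  refine Fin.cases ?_ (fun j => ?_) i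
  · exact measurable_fst (α := X)
  · exact (measurable_pi_apply j).comp (measurable_subtype_coe.comp (measurable_snd (α := X)))

theorem measurable_sectionToSpace (Y : Set X) (s : ℕ) : Measurable (sectionToSpace G Y s) :=
  ((measurable_concat Y s).comp measurable_subtype_coe).subtype_mk

variable [MeasurableSpace G]

instance [MeasurableSMul₂ G X] (r : ℕ) : MeasurableSMul₂ G (Fin r → X) :=
  ⟨measurable_pi_lambda _ fun i =>
    measurable_fst.smul ((measurable_pi_apply i).comp measurable_snd)⟩

instance [MeasurableSMul₂ G X] (Y : Set X) (r : ℕ) :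
    MeasurableSMul₂ G (intersectionSpace G Y r) :=
  ⟨(measurable_fst.smul (measurable_subtype_coe.comp measurable_snd) :
    Measurable fun p : G × intersectionSpace G Y r => p.1 • (p.2 : Fin r → X)).subtype_mk⟩

instance {Z : Type*} [MeasurableSpace Z] [MeasurableSMul₂ G X] :
    MeasurableSMul₂ G (FirstFactor X Z) :=
  ⟨(measurable_fst.smul (measurable_fst.comp measurable_snd) :
    Measurable fun p : G × (X × Z) => p.1 • p.2.1).prodMk (measurable_snd.comp measurable_snd)⟩

instance {Z : Type*} [MeasurableSpace Z] [StandardBorelSpace X] [StandardBorelSpace Z] :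
    StandardBorelSpace (FirstFactor X Z) :=
  inferInstanceAs (StandardBorelSpace (X × Z))

variable [TopologicalSpace G] [IsTopologicalGroup G] [LocallyCompactSpace G]
  [SecondCountableTopology G] [T2Space G] [BorelSpace G] [StandardBorelSpace X]
  [MeasurableSMul₂ G X]

/-- It is the projection along `G` of the Borel set of pairs `(g, x)` with `g • x ∈ Y^r`, whose
sections are locally finite. -/
theorem measurableSet_intersectionSpace {Y : Set X} (hY : MeasurableSet Y)
    (hfin : ∀ x, LocFinite (returnTimes G Y x)) {r : ℕ} (hr : 1 ≤ r) :
    MeasurableSet (intersectionSpace G Y r : Set (Fin r → X)) := by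
  have := polishSpace_of_locallyCompact_group G
  have h : (intersectionSpace G Y r : Set (Fin r → X)) =
      Prod.snd '' {p : G × (Fin r → X) | p.1 • p.2 ∈ univ.pi fun _ => Y} := by
    ext x
    simp [mem_intersectionSpace_iff]
  rw [h]
  exact measurableSet_snd_image_of_locFinite (measurable_smul (.univ_pi fun _ => hY))
    fun x => locFinite_returnTimes_pi hfin hr x

theorem standardBorelSpace_intersectionSpace {Y : Set X} (hY : MeasurableSet Y)
    (hfin : ∀ x, LocFinite (returnTimes G Y x)) {r : ℕ} (hr : 1 ≤ r) :
    StandardBorelSpace (intersectionSpace G Y r) :=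
  (measurableSet_intersectionSpace hY hfin hr).standardBorel

theorem measurableSet_intersectionSection {Y : Set X} (hY : MeasurableSet Y)
    (hfin : ∀ x, LocFinite (returnTimes G Y x)) (s : ℕ) :
    MeasurableSet (intersectionSection G Y s) :=
  measurable_concat Y s (measurableSet_intersectionSpace hY hfin (Nat.le_add_left 1 s))

end Measurability

/-! ### Coordinates on `Y^r` -/

section Coordinates

variable {G X : Type*} [Group G] [MulAction G X] [MeasurableSpace X]

variable (G) in
/-- The coordinates of a point of `Y^r`, seen as a subset of `Y^[r]`. -/
def powerSectionEquiv (Y : Set X) (r : ℕ) : powerSection G Y r ≃ᵐ (Fin r → Y) where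
  toFun z i := ⟨((z : intersectionSpace G Y r) : Fin r → X) i, z.2 i⟩
  invFun y := ⟨⟨fun i => y i, 1, fun i => y i, fun i => (y i).2, (one_smul _ _).symm⟩,
    fun i => (y i).2⟩
  left_inv _ := rfl
  right_inv _ := rfl
  measurable_toFun := measurable_pi_lambda _ fun i =>
    ((measurable_pi_apply i).comp (measurable_subtype_coe.comp measurable_subtype_coe)).subtype_mk
  measurable_invFun := (Measurable.subtype_mk
    (measurable_pi_lambda _ fun i => measurable_subtype_coe.comp (measurable_pi_apply i))).subtype_mk

end Coordinates

/-! ### The product measure on `X × Z` -/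

section FirstFactorMeasure

variable {G X Z : Type*} [Group G] [MulAction G X] [MeasurableSpace X] [MeasurableSpace Z]

theorem smulInvariantMeasure_firstFactorMeasure [MeasurableConstSMul G X] (μ : Measure X)
    (ν : Measure Z) [SFinite μ] [SFinite ν] [SMulInvariantMeasure G X μ] :
    SMulInvariantMeasure G (FirstFactor X Z) (firstFactorMeasure μ ν) :=
  ⟨fun c _ ht => ((measurePreserving_smul c μ).prod (.id ν)).measure_preimage
    ht.nullMeasurableSet⟩

theorem sigmaFinite_firstFactorMeasure (μ : Measure X) (ν : Measure Z) [SigmaFinite μ]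
    [SigmaFinite ν] : SigmaFinite (firstFactorMeasure μ ν) :=
  inferInstanceAs (SigmaFinite (μ.prod ν))

theorem ae_firstFactorMeasure {μ : Measure X} {ν : Measure Z} [SFinite ν] {q : X → Prop}
    (h : ∀ᵐ x ∂μ, q x) : ∀ᵐ p ∂(firstFactorMeasure μ ν), q p.1 :=
  Measure.quasiMeasurePreserving_fst.ae h

end FirstFactorMeasure

/-! ### Testing transverse measures on boxes -/

section Boxes

variable {G X : Type*} [Group G] [MulAction G X] [TopologicalSpace G] [LocallyCompactSpace G]
  [MeasurableSpace G] [MeasurableSpace X] (m : Measure G) {μ : Measure X} {Y : Set X}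

theorem lintegral_indicator_transverseMeasure {r : ℕ} (ν : Measure (intersectionSpace G Y r))
    {B : Set (Fin r → X)} (hB : MeasurableSet B) :
    ∫⁻ z, B.indicator 1 ((z : intersectionSpace G Y r) : Fin r → X)
      ∂transverseMeasure m ν (powerSection G Y r) =
    (transverseMeasure m ν (powerSection G Y r)).map (powerSectionEquiv G Y r)
      {y | (fun i => (y i : X)) ∈ B} := by
  rw [MeasurableEquiv.map_apply, ← lintegral_indicator_one]
  · rfl
  · exact (measurable_subtype_coe.comp measurable_subtype_coe) hB

/-- A measure on `Y^[r]` has transverse measure `μ_Y ⊗ ⋯ ⊗ μ_Y` if it does on boxes. -/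
theorem map_transverseMeasure_eq_pi {r : ℕ} {ν : Measure (intersectionSpace G Y r)}
    [SigmaFinite (transverseMeasure m μ Y)]
    (h : ∀ t : Fin r → Set X, (∀ i, MeasurableSet (t i)) →
      ∫⁻ z, (univ.pi t).indicator 1 ((z : intersectionSpace G Y r) : Fin r → X)
        ∂transverseMeasure m ν (powerSection G Y r) =
      ∏ i, transverseMeasure m μ Y (Subtype.val ⁻¹' t i)) :
    (transverseMeasure m ν (powerSection G Y r)).map (powerSectionEquiv G Y r) =
      Measure.pi fun _ : Fin r => transverseMeasure m μ Y := by
  refine (Measure.pi_eq fun t ht => ?_).symm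
  choose u hu hut using ht
  obtain rfl : (fun i => Subtype.val ⁻¹' u i) = t := funext hut
  rw [← h u hu, lintegral_indicator_transverseMeasure m ν (.univ_pi hu)]
  congr 1

theorem IsIntersectionMeasure.lintegral_indicator {r : ℕ} {ν : Measure (intersectionSpace G Y r)}
    [SigmaFinite (transverseMeasure m μ Y)] (h : IsIntersectionMeasure m μ Y r ν)
    {t : Fin r → Set X} (ht : ∀ i, MeasurableSet (t i)) :
    ∫⁻ z, (univ.pi t).indicator 1 ((z : intersectionSpace G Y r) : Fin r → X)
        ∂transverseMeasure m ν (powerSection G Y r) =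
      ∏ i, transverseMeasure m μ Y (Subtype.val ⁻¹' t i) := by
  have h1 := congrArg (fun ρ => ρ (univ.pi fun i => Subtype.val ⁻¹' t i)) h.transverse_eq
  simp only [Measure.pi_pi] at h1
  rw [← h1, lintegral_indicator_transverseMeasure m ν (.univ_pi ht)]
  congr 1

end Boxes

variable {G X : Type*} [Group G] [TopologicalSpace G] [IsTopologicalGroup G]
  [LocallyCompactSpace G] [SecondCountableTopology G] [T2Space G] [MeasurableSpace G] [BorelSpace G]
  [MeasurableSpace X] [StandardBorelSpace X] [MulAction G X] [MeasurableSMul₂ G X]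

/-! ### Uniqueness, and existence in order one -/

section Existence

variable (m : Measure G) [m.IsHaarMeasure] [m.IsMulRightInvariant] {μ : Measure X} {Y : Set X}

/-- The intersection measure is unique. -/
theorem IsIntersectionMeasure.unique (hY : MeasurableSet Y)
    (hfin : ∀ x, LocFinite (returnTimes G Y x)) {s : ℕ} (hs : 1 ≤ s)
    {ν ν' : Measure (intersectionSpace G Y s)} (h : IsIntersectionMeasure m μ Y s ν)
    (h' : IsIntersectionMeasure m μ Y s ν') : ν = ν' := by
  have := standardBorelSpace_intersectionSpace hY hfin hs
  have := h.sigmaFinite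
  have := h'.sigmaFinite
  have := h.invariant
  have := h'.invariant
  exact eq_of_transverseMeasure_eq m ν ν' (measurableSet_powerSection hY s)
    (locFinite_returnTimes_powerSection hfin hs)
    (.of_forall (returnTimes_powerSection_nonempty Y s))
    (.of_forall (returnTimes_powerSection_nonempty Y s))
    ((powerSectionEquiv G Y s).map_measurableEquiv_injective
      (h.transverse_eq.trans h'.transverse_eq.symm))

/-- The intersection measure of order `1` is the restriction of `μ` to `G.Y`. -/
theorem exists_isIntersectionMeasure_one [IsFiniteMeasure μ] [SMulInvariantMeasure G X μ]
    (hY : MeasurableSet Y) (hfin : ∀ x, LocFinite (returnTimes G Y x)) :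
    ∃ ν, IsIntersectionMeasure m μ Y 1 ν := by
  have := standardBorelSpace_intersectionSpace hY hfin le_rfl
  have := sigmaFinite_transverseMeasure m μ hY hfin
  let j : intersectionSpace G Y 1 → X := fun z => (z : Fin 1 → X) 0
  have hjm : Measurable j := (measurable_pi_apply 0).comp measurable_subtype_coe
  have hj : MeasurableEmbedding j := hjm.measurableEmbedding fun z z' h =>
    Subtype.ext (funext fun i => by rw [Subsingleton.elim i 0]; exact h)
  have hrange : ∀ x, x ∉ range j → returnTimes G Y x = ∅ := by
    refine fun x hx => eq_empty_of_forall_notMem fun g hg => hx ?_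
    exact ⟨⟨fun _ => x, mem_intersectionSpace_iff.2 ⟨g, fun _ => hg⟩⟩, rfl⟩
  have hfinite : IsFiniteMeasure (μ.comap j) := ⟨by
    rw [hj.comap_apply]
    exact measure_lt_top _ _⟩
  refine ⟨μ.comap j, inferInstance, ⟨fun c t ht => ?_⟩, ?_⟩
  · rw [hj.comap_apply, hj.comap_apply, ← measure_preimage_smul (μ := μ) c (j '' t)]
    congr 1
    ext x
    constructor
    · rintro ⟨z, hz, rfl⟩
      exact ⟨c • z, hz, rfl⟩
    · rintro ⟨z, hz, hzx⟩
      refine ⟨c⁻¹ • z, by simpa using hz, ?_⟩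
      change c⁻¹ • j z = x
      rw [hzx, inv_smul_smul]
  · refine map_transverseMeasure_eq_pi m fun t ht => ?_
    have hone : Measurable ((t 0).indicator (1 : X → ℝ≥0∞)) := measurable_one.indicator (ht 0)
    have e1 : ∀ z : Fin 1 → X, (univ.pi t).indicator (1 : (Fin 1 → X) → ℝ≥0∞) z =
        (t 0).indicator 1 (z 0) := fun z => by
      classical simp [indicator_apply]
    simp only [e1]
    rw [Fin.prod_univ_one, ← lintegral_indicator_one (measurable_subtype_coe (ht 0))]
    rw [lintegral_transverseMeasure m _ (measurableSet_powerSection hY 1)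
      (locFinite_returnTimes_powerSection hfin le_rfl) (f := fun z => (t 0).indicator 1 (j z))
      (hone.comp hjm)]
    have e2 := lintegral_transverseMeasure m μ hY hfin hone
    refine Eq.trans ?_ e2.symm
    -- `H` vanishes off `G.Y`, where return times sets are empty, so restricting `μ` to `G.Y` does
    -- not change its integral.
    let H : X → ℝ≥0∞ := fun x =>
      ∑' g : returnTimes G Y x, weight m g * (t 0).indicator 1 ((g : G) • x)
    have hH : ∀ z : intersectionSpace G Y 1, ∑' g : returnTimes G (powerSection G Y 1) z,
        weight m g * (t 0).indicator 1 (j ((g : G) • z)) = H (j z) := by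
      intro z
      refine (Equiv.setCongr ?_).tsum_eq
        (fun g : returnTimes G Y (j z) => weight m g * (t 0).indicator 1 ((g : G) • j z))
      ext g
      simp [returnTimes, powerSection, j]
    simp only [hH]
    change _ = ∫⁻ x, H x ∂μ
    rw [← hj.lintegral_map, hj.map_comap]
    rw [← lintegral_indicator hj.measurableSet_range]
    refine lintegral_congr fun x => ?_
    by_cases hx : x ∈ range j
    · rw [indicator_of_mem hx]
    · rw [indicator_of_notMem hx]
      have := hrange x hx
      have : IsEmpty (returnTimes G Y x) := isEmpty_coe_sort.2 this
      simp [H]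

end Existence

/-! ### Inductive step: from `Y^[s]` to `Y^[s+1]` -/

variable {G X : Type*} [Group G] [MulAction G X]

/-- A sum over the pairs `(g, h)` for which `h.(g.x, z) ∈ Y × Y^s` is a sum over the pairs
`(k, h)` for which `k.x ∈ Y` and `h.z ∈ Y^s`, through `k = hg`. -/
theorem tsum_returnTimes_intersectionSection {Y : Set X} {s : ℕ} (p : ExtendedSpace G Y s)
    (w : G → ℝ≥0∞) (a : X → ℝ≥0∞) (b : (Fin s → X) → ℝ≥0∞) :
    ∑' g : returnTimes G (intersectionSection G Y s) p, w g *
        ∑' h : returnTimes G (univ.pi fun _ => Y) (concat G Y s ((g : G) • p)),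
          w h * (a ((h : G) • (g : G) • p.1) * b ((h : G) • (p.2 : Fin s → X))) =
      ∑' h : returnTimes G (powerSection G Y s) p.2, w h * b ((h : G) • (p.2 : Fin s → X)) *
        ∑' k : returnTimes G Y p.1, w ((h : G)⁻¹ * k) * a ((k : G) • p.1) := by
  classical
  -- The common summand, extended by zero to `G × G`; both sides are its iterated sums, in opposite
  -- orders.
  let U : G → G → ℝ≥0∞ := fun h g =>
    if (h * g) • p.1 ∈ Y ∧ ∀ i, h • (p.2 : Fin s → X) i ∈ Y then
      w g * (w h * (a (h • g • p.1) * b (h • (p.2 : Fin s → X)))) else 0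
  have hmem : ∀ g h, h ∈ returnTimes G (univ.pi fun _ => Y) (concat G Y s (g • p)) ↔
      (h * g) • p.1 ∈ Y ∧ ∀ i, h • (p.2 : Fin s → X) i ∈ Y := by
    intro g h
    change h • Fin.cons (α := fun _ => X) (g • p.1) (p.2 : Fin s → X) ∈ univ.pi (fun _ => Y) ↔ _
    simp [Fin.forall_fin_succ, mul_smul]
  have hleft : ∀ g, (returnTimes G (intersectionSection G Y s) p).indicator (fun g => w g *
        ∑' h : returnTimes G (univ.pi fun _ => Y) (concat G Y s ((g : G) • p)),
          w h * (a ((h : G) • (g : G) • p.1) * b ((h : G) • (p.2 : Fin s → X)))) g =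
      ∑' h, U h g := by
    intro g
    by_cases hg : g ∈ returnTimes G (intersectionSection G Y s) p
    · rw [indicator_of_mem hg, ← ENNReal.tsum_mul_left]
      rw [tsum_subtype (returnTimes G (univ.pi fun _ => Y) (concat G Y s (g • p)))
        fun h => w g * (w h * (a (h • g • p.1) * b (h • (p.2 : Fin s → X))))]
      refine tsum_congr fun h => ?_
      simp only [indicator_apply, hmem, U]
    · rw [indicator_of_notMem hg]
      refine (ENNReal.tsum_eq_zero.2 fun h => if_neg fun hh => hg ?_).symm
      exact mem_returnTimes_intersectionSection.2 ⟨h, hh⟩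
  have hright : ∀ h, (returnTimes G (powerSection G Y s) p.2).indicator (fun h =>
        w h * b (h • (p.2 : Fin s → X)) *
        ∑' k : returnTimes G Y p.1, w (h⁻¹ * k) * a ((k : G) • p.1)) h = ∑' g, U h g := by
    intro h
    have hmem' : h ∈ returnTimes G (powerSection G Y s) p.2 ↔
        ∀ i, h • (p.2 : Fin s → X) i ∈ Y := Iff.rfl
    by_cases hh : ∀ i, h • (p.2 : Fin s → X) i ∈ Y
    · rw [indicator_of_mem (hmem'.2 hh), tsum_subtype (returnTimes G Y p.1)
        fun k => w (h⁻¹ * k) * a (k • p.1), ← (Equiv.mulLeft h).tsum_eq, ← ENNReal.tsum_mul_left]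
      refine tsum_congr fun g => ?_
      simp only [Equiv.coe_mulLeft, indicator_apply, U, hh, returnTimes, mem_ofPred_eq, and_true,
        inv_mul_cancel_left, mul_smul, mul_ite, mul_zero, implies_true]
      split_ifs
      · ring
      · rfl
    · rw [indicator_of_notMem (hmem'.not.2 hh)]
      exact (ENNReal.tsum_eq_zero.2 fun g => if_neg fun hc => hh hc.2).symm
  rw [tsum_subtype (returnTimes G (intersectionSection G Y s) p) fun g => w g *
        ∑' h : returnTimes G (univ.pi fun _ => Y) (concat G Y s ((g : G) • p)),
          w h * (a ((h : G) • (g : G) • p.1) * b ((h : G) • (p.2 : Fin s → X))),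
    tsum_subtype (returnTimes G (powerSection G Y s) p.2) fun h =>
        w h * b (h • (p.2 : Fin s → X)) *
        ∑' k : returnTimes G Y p.1, w (h⁻¹ * k) * a ((k : G) • p.1)]
  simp only [hleft, hright]
  exact ENNReal.tsum_comm

theorem smul_mem_intersectionSpace_iff {Y : Set X} {r : ℕ} (c : G) {x : Fin r → X} :
    c • x ∈ intersectionSpace G Y r ↔ x ∈ intersectionSpace G Y r :=
  ⟨fun h => by simpa using (intersectionSpace G Y r).smul_mem c⁻¹ h,
    (intersectionSpace G Y r).smul_mem c⟩

theorem smul_concat {Y : Set X} {s : ℕ} (c : G) (p : ExtendedSpace G Y s) :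
    c • concat G Y s p = concat G Y s (c • p.1, c • p.2) := by
  funext i
  refine Fin.cases rfl (fun j => rfl) i

variable [TopologicalSpace G] [IsTopologicalGroup G]
  [LocallyCompactSpace G] [SecondCountableTopology G] [T2Space G] [MeasurableSpace G] [BorelSpace G]
  [MeasurableSpace X]

/-- The measure on `Y^[s+1]` induced by a measure `ν` on `Y^[s]`: the transverse measure of the
cross section `Y^[s+1]` of `X × Y^[s]` with respect to `μ ⊗ ν`. -/
noncomputable def inducedMeasure (m : Measure G) (μ : Measure X) (Y : Set X) (s : ℕ)
    (ν : Measure (intersectionSpace G Y s)) : Measure (intersectionSpace G Y (s + 1)) :=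
  (transverseMeasure m (firstFactorMeasure μ ν) (intersectionSection G Y s)).map
    (sectionToSpace G Y s)

variable [StandardBorelSpace X] [MeasurableSMul₂ G X] (m : Measure G) {μ : Measure X} {Y : Set X} {s : ℕ}
  (ν : Measure (intersectionSpace G Y s))

theorem lintegral_inducedMeasure
    (hY : MeasurableSet Y)
    (hstar : ∀ x₁ x₂ : X, LocFinite ((returnTimes G Y x₁)⁻¹ * returnTimes G Y x₂))
    (hfin : ∀ x, LocFinite (returnTimes G Y x)) (hs : 1 ≤ s)
    {f : (Fin (s + 1) → X) → ℝ≥0∞} (hf : Measurable f) :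
    ∫⁻ v, f (v : Fin (s + 1) → X) ∂inducedMeasure m μ Y s ν =
      ∫⁻ p, ∑' g : returnTimes G (intersectionSection G Y s) p,
        weight m g * f (concat G Y s ((g : G) • p)) ∂firstFactorMeasure μ ν := by
  have := standardBorelSpace_intersectionSpace hY hfin hs
  have hf' : Measurable fun v : intersectionSpace G Y (s + 1) => f v := hf.comp measurable_subtype_coe
  rw [inducedMeasure, lintegral_map hf'
    (measurable_sectionToSpace Y s)]
  exact lintegral_transverseMeasure m (firstFactorMeasure μ ν)
    (measurableSet_intersectionSection hY hfin s)
    (locFinite_returnTimes_intersectionSection hstar hs) (hf.comp (measurable_concat Y s))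

variable [m.IsHaarMeasure] [m.IsMulRightInvariant] [SigmaFinite μ] [SMulInvariantMeasure G X μ]
  [SigmaFinite ν]

theorem sigmaFinite_inducedMeasure
    (hY : MeasurableSet Y)
    (hstar : ∀ x₁ x₂ : X, LocFinite ((returnTimes G Y x₁)⁻¹ * returnTimes G Y x₂))
    (hfin : ∀ x, LocFinite (returnTimes G Y x)) (hs : 1 ≤ s) :
    SigmaFinite (inducedMeasure m μ Y s ν) := by
  have := standardBorelSpace_intersectionSpace hY hfin hs
  have := smulInvariantMeasure_firstFactorMeasure (G := G) μ ν
  have := sigmaFinite_firstFactorMeasure μ ν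
  have hS := measurableSet_intersectionSection (G := G) hY hfin s
  have := sigmaFinite_transverseMeasure m (firstFactorMeasure μ ν) hS
    (locFinite_returnTimes_intersectionSection hstar hs)
  have : StandardBorelSpace (intersectionSection G Y s) := hS.standardBorel
  have := standardBorelSpace_intersectionSpace (G := G) hY hfin (Nat.le_add_left 1 s)
  -- An injective Borel map between standard Borel spaces is a Borel embedding, so pushing forward
  -- preserves `σ`-finiteness.
  exact ((measurable_sectionToSpace Y s).measurableEmbedding
    (sectionToSpace_bijective G Y s).1).sigmaFinite_map

/-- The diagonal action of `c` on `(g.x, z)` gives `(cg.x, c.z)`. The map `T : (x, z) ↦ (x, c.z)`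
preserves `μ ⊗ ν` and multiplies return times on the left by `c`. The weight becomes its translate
by `c⁻¹`, still of integral one, so the transverse measure is unchanged. -/
theorem smulInvariantMeasure_inducedMeasure
    (hY : MeasurableSet Y)
    (hstar : ∀ x₁ x₂ : X, LocFinite ((returnTimes G Y x₁)⁻¹ * returnTimes G Y x₂))
    (hfin : ∀ x, LocFinite (returnTimes G Y x)) (hs : 1 ≤ s)
    [SMulInvariantMeasure G (intersectionSpace G Y s) ν] :
    SMulInvariantMeasure G (intersectionSpace G Y (s + 1)) (inducedMeasure m μ Y s ν) := by
  have := standardBorelSpace_intersectionSpace hY hfin hs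
  have := smulInvariantMeasure_firstFactorMeasure (G := G) μ ν
  have := sigmaFinite_firstFactorMeasure μ ν
  have hS := measurableSet_intersectionSection (G := G) hY hfin s
  have hSfin := locFinite_returnTimes_intersectionSection hstar hs
  refine ⟨fun c u hu => ?_⟩
  obtain ⟨t, ht, rfl⟩ := hu
  have e : ∀ B : Set (Fin (s + 1) → X), MeasurableSet B →
      inducedMeasure m μ Y s ν (Subtype.val ⁻¹' B) =
        ∫⁻ v, B.indicator 1 (v : Fin (s + 1) → X) ∂inducedMeasure m μ Y s ν := fun B hB =>
    (lintegral_indicator_one (measurable_subtype_coe hB)).symm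
  let T : ExtendedSpace G Y s → ExtendedSpace G Y s := fun p => (p.1, c • p.2)
  have hT : MeasurePreserving T (firstFactorMeasure μ ν) (firstFactorMeasure μ ν) :=
    (MeasurePreserving.id μ).prod (measurePreserving_smul c ν)
  have hret : ∀ p g, g ∈ returnTimes G (intersectionSection G Y s) p ↔
      c * g ∈ returnTimes G (intersectionSection G Y s) (T p) := by
    intro p g
    change concat G Y s (g • p) ∈ intersectionSpace G Y (s + 1) ↔
      concat G Y s ((c * g) • T p) ∈ intersectionSpace G Y (s + 1)
    rw [← smul_mem_intersectionSpace_iff c, smul_concat,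
      show ((c * g) • T p) = (c • (g • p).1, c • (g • p).2) from Prod.ext (mul_smul c g p.1) rfl]
  let f : (Fin (s + 1) → X) → ℝ≥0∞ := t.indicator 1
  have hf : Measurable f := measurable_one.indicator ht
  have hct : MeasurableSet ((c • ·) ⁻¹' t : Set (Fin (s + 1) → X)) := measurable_const_smul c ht
  let H : ExtendedSpace G Y s → ℝ≥0∞ := fun p =>
    ∑' g : returnTimes G (intersectionSection G Y s) p,
      weight m (c⁻¹ * g) * f (concat G Y s ((g : G) • p))
  have hw : Measurable fun g => weight m (c⁻¹ * g) :=
    (measurable_weight m).comp (measurable_const_mul _)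
  have hH : Measurable H := by
    refine measurable_tsum_returnTimes hS hSfin measurable_id
      (F := fun g p => weight m (c⁻¹ * g) * f (concat G Y s (g • p))) ?_
    exact (hw.comp measurable_fst).mul
      (hf.comp ((measurable_concat Y s).comp measurable_smul))
  have hHT : ∀ p, ∑' g : returnTimes G (intersectionSection G Y s) p,
      weight m g * ((c • ·) ⁻¹' t : Set (Fin (s + 1) → X)).indicator 1
        (concat G Y s ((g : G) • p)) = H (T p) := by
    intro p
    refine Eq.trans (tsum_congr fun g => ?_)
      ((Equiv.subtypeEquiv (Equiv.mulLeft c) (hret p)).tsum_eq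
        (fun g : returnTimes G (intersectionSection G Y s) (T p) =>
          weight m (c⁻¹ * g) * f (concat G Y s ((g : G) • T p))))
    change _ = weight m (c⁻¹ * (c * g)) * f (concat G Y s ((c * (g : G)) • T p))
    rw [inv_mul_cancel_left, show ((c * g) • T p) = (c • ((g : G) • p).1, c • ((g : G) • p).2) from
      Prod.ext (mul_smul c g p.1) rfl, ← smul_concat]
    rfl
  rw [show (fun v : intersectionSpace G Y (s + 1) => c • v) ⁻¹' (Subtype.val ⁻¹' t) =
    Subtype.val ⁻¹' ((c • ·) ⁻¹' t) from rfl, e _ hct, e t ht,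
    lintegral_inducedMeasure m ν hY hstar hfin hs (measurable_one.indicator hct),
    lintegral_inducedMeasure m ν hY hstar hfin hs (measurable_one.indicator ht)]
  simp only [hHT]
  rw [hT.lintegral_comp hH]
  have hfc : Measurable fun p => f (concat G Y s p) := hf.comp (measurable_concat Y s)
  exact (lintegral_tsum_returnTimes_weight m _ hS hSfin hw (lintegral_weight_mul_left m c⁻¹)
    hfc).trans (lintegral_transverseMeasure m _ hS hSfin hfc)

/-- The heart of the inductive step: the substitution `k = hg` decouples the sum over `Y_x` from the
sum over the return times of `z`. -/
theorem lintegral_mul_transverseMeasure_inducedMeasure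
    (hY : MeasurableSet Y)
    (hstar : ∀ x₁ x₂ : X, LocFinite ((returnTimes G Y x₁)⁻¹ * returnTimes G Y x₂))
    (hfin : ∀ x, LocFinite (returnTimes G Y x)) (hs : 1 ≤ s)
    {a : X → ℝ≥0∞} (ha : Measurable a) {b : (Fin s → X) → ℝ≥0∞} (hb : Measurable b) :
    ∫⁻ v, (fun x : Fin (s + 1) → X => a (x 0) * b (fun i : Fin s => x i.succ))
        ((v : intersectionSpace G Y (s + 1)) : Fin (s + 1) → X)
        ∂transverseMeasure m (inducedMeasure m μ Y s ν) (powerSection G Y (s + 1)) =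
      (∫⁻ y, a y ∂transverseMeasure m μ Y) *
        ∫⁻ z, b ((z : intersectionSpace G Y s) : Fin s → X)
          ∂transverseMeasure m ν (powerSection G Y s) := by
  have := standardBorelSpace_intersectionSpace hY hfin hs
  have := standardBorelSpace_intersectionSpace (G := G) hY hfin (Nat.le_add_left 1 s)
  have hw := measurable_weight m
  have htail : Measurable fun (v : Fin (s + 1) → X) (i : Fin s) => v i.succ :=
    measurable_pi_lambda _ fun i => measurable_pi_apply i.succ
  let f : (Fin (s + 1) → X) → ℝ≥0∞ := fun v => a (v 0) * b (fun i : Fin s => v i.succ)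
  have hf : Measurable f := (ha.comp (measurable_pi_apply 0)).mul (hb.comp htail)
  have hfs : Measurable fun v : intersectionSpace G Y (s + 1) => f v :=
    hf.comp measurable_subtype_coe
  have hSm := measurableSet_powerSection (G := G) hY (s + 1)
  have hSf := locFinite_returnTimes_powerSection hfin (Nat.le_add_left 1 s)
  have e := lintegral_transverseMeasure m (inducedMeasure m μ Y s ν) hSm hSf hfs
  refine e.trans ?_
  -- Defined on all of `X^(s+1)`, so that `lintegral_inducedMeasure` applies to it.
  let Φ : (Fin (s + 1) → X) → ℝ≥0∞ := fun v =>
    ∑' h : returnTimes G (univ.pi fun _ => Y) v,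
      weight m h * (a ((h : G) • v 0) * b ((h : G) • fun i : Fin s => v i.succ))
  have hΦ : Measurable Φ := by
    refine measurable_tsum_returnTimes (.univ_pi fun _ => hY)
      (locFinite_returnTimes_pi hfin (Nat.le_add_left 1 s)) measurable_id
      (F := fun h v => weight m h * (a (h • v 0) * b (h • fun i : Fin s => v i.succ))) ?_
    refine (hw.comp measurable_fst).mul ((ha.comp ?_).mul (hb.comp ?_))
    · exact measurable_fst.smul ((measurable_pi_apply 0).comp measurable_snd)
    · exact measurable_fst.smul (htail.comp measurable_snd)
  have hΦv : ∀ v : intersectionSpace G Y (s + 1),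
      ∑' h : returnTimes G (powerSection G Y (s + 1)) v, weight m h *
        f ((h : G) • v : intersectionSpace G Y (s + 1)) = Φ v := fun v =>
    (Equiv.setCongr (returnTimes_powerSection Y (s + 1) v)).tsum_eq
      (fun h : returnTimes G (univ.pi fun _ => Y) (v : Fin (s + 1) → X) =>
        weight m h * (a ((h : G) • (v : Fin (s + 1) → X) 0) *
          b ((h : G) • fun i : Fin s => (v : Fin (s + 1) → X) i.succ)))
  simp only [hΦv]
  rw [lintegral_inducedMeasure m ν hY hstar hfin hs hΦ]
  have hmeas : Measurable fun p : ExtendedSpace G Y s =>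
      ∑' g : returnTimes G (intersectionSection G Y s) p,
        weight m g * Φ (concat G Y s ((g : G) • p)) := by
    refine measurable_tsum_returnTimes (measurableSet_intersectionSection hY hfin s)
      (locFinite_returnTimes_intersectionSection hstar hs) measurable_id
      (F := fun g p => weight m g * Φ (concat G Y s (g • p))) ?_
    exact (hw.comp measurable_fst).mul
      (hΦ.comp ((measurable_concat Y s).comp measurable_smul))
  -- Integrate in `x` first, with `z` fixed: the sum over `h` then runs over a fixed countable set
  -- and can leave the integral.
  refine (lintegral_prod_symm (μ := μ) (ν := ν) _ hmeas.aemeasurable).trans ?_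
  have hbs : Measurable fun z : intersectionSpace G Y s => b (z : Fin s → X) :=
    hb.comp measurable_subtype_coe
  rw [lintegral_transverseMeasure m ν (measurableSet_powerSection hY s)
    (locFinite_returnTimes_powerSection hfin hs) hbs, ← lintegral_const_mul]
  swap
  · exact measurable_tsum_returnTimes (measurableSet_powerSection hY s)
      (locFinite_returnTimes_powerSection hfin hs) measurable_id
      (F := fun h z => weight m h * b ((h • z : intersectionSpace G Y s) : Fin s → X))
      ((hw.comp measurable_fst).mul (hbs.comp measurable_smul))
  refine lintegral_congr fun z => ?_
  have := (locFinite_returnTimes_powerSection hfin hs z).countable.to_subtype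
  have hsum : ∀ h : G, Measurable fun x =>
      ∑' k : returnTimes G Y x, weight m (h⁻¹ * k) * a ((k : G) • x) := fun h => by
    refine measurable_tsum_returnTimes hY hfin measurable_id
      (F := fun k x => weight m (h⁻¹ * k) * a (k • x)) ?_
    exact (hw.comp (measurable_fst.const_mul _)).mul (ha.comp measurable_smul)
  let p : X → ExtendedSpace G Y s := fun x => (x, z)
  refine (lintegral_congr fun x =>
    tsum_returnTimes_intersectionSection (p x) (weight m) a b).trans ?_
  calc ∫⁻ x, ∑' h : returnTimes G (powerSection G Y s) z,
          weight m h * b ((h : G) • (z : Fin s → X)) *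
          ∑' k : returnTimes G Y x, weight m ((h : G)⁻¹ * k) * a ((k : G) • x) ∂μ
      = ∑' h : returnTimes G (powerSection G Y s) z,
          weight m h * b ((h : G) • (z : Fin s → X)) * ∫⁻ y, a y ∂transverseMeasure m μ Y := by
        rw [lintegral_tsum (f := fun (h : returnTimes G (powerSection G Y s) z) x =>
            weight m h * b ((h : G) • (z : Fin s → X)) *
            ∑' k : returnTimes G Y x, weight m ((h : G)⁻¹ * k) * a ((k : G) • x))
          fun h => ((hsum h).const_mul _).aemeasurable]
        refine tsum_congr fun h => ?_
        -- The weight `k ↦ w(h⁻¹k)` has integral one, so the inner integral equals `μ_Y(a)` for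
        -- every `h`.
        rw [lintegral_const_mul _ (hsum h),
          lintegral_tsum_returnTimes_weight m μ hY hfin (w := fun k => weight m ((h : G)⁻¹ * k))
            (hw.comp (measurable_const_mul _)) (lintegral_weight_mul_left m _) ha]
    _ = _ := by
        rw [ENNReal.tsum_mul_right, mul_comm]
        rfl

theorem isIntersectionMeasure_inducedMeasure
    (hY : MeasurableSet Y)
    (hstar : ∀ x₁ x₂ : X, LocFinite ((returnTimes G Y x₁)⁻¹ * returnTimes G Y x₂))
    (hfin : ∀ x, LocFinite (returnTimes G Y x)) (hs : 1 ≤ s)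
    (h : IsIntersectionMeasure m μ Y s ν) :
    IsIntersectionMeasure m μ Y (s + 1) (inducedMeasure m μ Y s ν) := by
  have := h.invariant
  have := sigmaFinite_transverseMeasure m μ hY hfin
  refine ⟨sigmaFinite_inducedMeasure m ν hY hstar hfin hs,
    smulInvariantMeasure_inducedMeasure m ν hY hstar hfin hs, ?_⟩
  refine map_transverseMeasure_eq_pi m fun t ht => ?_
  rw [Fin.prod_univ_succ, ← h.lintegral_indicator m fun i => ht i.succ,
    ← lintegral_indicator_one (measurable_subtype_coe (ht 0))]
  refine Eq.trans (lintegral_congr fun v => ?_)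
    (lintegral_mul_transverseMeasure_inducedMeasure m ν hY hstar hfin hs
      (a := (t 0).indicator 1) (measurable_one.indicator (ht 0))
      (b := (univ.pi fun i : Fin s => t i.succ).indicator 1)
      (measurable_one.indicator (.univ_pi fun i => ht i.succ)))
  classical
  simp only [indicator_apply, mem_univ_pi, Fin.forall_fin_succ, Pi.one_apply]
  split_ifs <;> simp_all

end Transverse

/-! ### The theorem, with `r = s + 1` -/

theorem mainTheorem10
    {G X : Type*} [Group G] [TopologicalSpace G] [IsTopologicalGroup G] [LocallyCompactSpace G]
    [SecondCountableTopology G] [T2Space G] [MeasurableSpace G] [BorelSpace G]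
    (m : Measure G) [m.IsHaarMeasure] [m.IsMulRightInvariant]
    [MeasurableSpace X] [StandardBorelSpace X] [MulAction G X] [MeasurableSMul₂ G X]
    (μ : Measure X) [IsProbabilityMeasure μ] [SMulInvariantMeasure G X μ]
    (Y : Set X) (hY : IsLocallyIntegrableCrossSection G μ Y)
    (hstar : ∀ x₁ x₂ : X, LocFinite ((returnTimes G Y x₁)⁻¹ * returnTimes G Y x₂))
    (s : ℕ) (hs : 1 ≤ s) :
    -- the intersection measures of orders `s` and `r = s + 1` are well defined
    (∃! ν, IsIntersectionMeasure m μ Y s ν) ∧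
    (∃! ν, IsIntersectionMeasure m μ Y (s + 1) ν) ∧
    -- `μ ⊗ μ^[s]` is an invariant `σ`-finite measure on `X × Y^[s]`
    SMulInvariantMeasure G (ExtendedSpace G Y s)
      (firstFactorMeasure μ (intersectionMeasure m μ Y s)) ∧
    SigmaFinite (firstFactorMeasure μ (intersectionMeasure m μ Y s)) ∧
    -- `Y^[s+1]` is a cross section of `X × Y^[s]`, which meets the orbit of every `(x, z)` for which
    -- `Y` meets the orbit of `x`
    IsCrossSection G (firstFactorMeasure μ (intersectionMeasure m μ Y s))
      (intersectionSection G Y s) ∧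
    (∀ p : ExtendedSpace G Y s, (returnTimes G Y p.1).Nonempty →
      (returnTimes G (intersectionSection G Y s) p).Nonempty) ∧
    -- the transverse measure of `Y^[s+1]` is the intersection measure of order `s + 1`
    intersectionMeasure m μ Y (s + 1) =
      (transverseMeasure m (firstFactorMeasure μ (intersectionMeasure m μ Y s))
        (intersectionSection G Y s)).map (sectionToSpace G Y s) := by
  have hYm := hY.measurableSet
  have hfin := hY.locFinite
  have hex : ∀ r, 1 ≤ r → ∃ ν, IsIntersectionMeasure m μ Y r ν := by
    intro r hr
    induction r, hr using Nat.le_induction with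
    | base => exact exists_isIntersectionMeasure_one m hYm hfin
    | succ r hr ih =>
      obtain ⟨ν, hν⟩ := ih
      have := hν.sigmaFinite
      exact ⟨_, isIntersectionMeasure_inducedMeasure m ν hYm hstar hfin hr hν⟩
  -- `intersectionMeasure` is chosen by `Classical.epsilon`, so it has the defining property only
  -- once existence is known.
  have hspec : ∀ r, 1 ≤ r → IsIntersectionMeasure m μ Y r (intersectionMeasure m μ Y r) :=
    fun r hr => Classical.epsilon_spec (hex r hr)
  have huniq : ∀ r, 1 ≤ r → ∃! ν, IsIntersectionMeasure m μ Y r ν := fun r hr =>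
    ⟨_, hspec r hr, fun ν hν => hν.unique m hYm hfin hr (hspec r hr)⟩
  have hs' : 1 ≤ s + 1 := Nat.le_add_left 1 s
  have := (hspec s hs).sigmaFinite
  refine ⟨huniq s hs, huniq (s + 1) hs', smulInvariantMeasure_firstFactorMeasure μ _,
    sigmaFinite_firstFactorMeasure μ _, ⟨measurableSet_intersectionSection hYm hfin s,
      locFinite_returnTimes_intersectionSection hstar hs, ?_⟩,
    returnTimes_intersectionSection_nonempty, ?_⟩
  · exact (ae_firstFactorMeasure hY.conull).mono returnTimes_intersectionSection_nonempty
  · exact (hspec (s + 1) hs').unique m hYm hfin hs'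
      (isIntersectionMeasure_inducedMeasure m _ hYm hstar hfin hs (hspec s hs))
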